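/- Let $1<p<2$ and let $p^*=p/(p-1)$ be its Hölder conjugate. For $q\ge 1$ write $\|x\|_q=(\sum_{i=1}^n|x_i|^q)^{1/q}$ for $x\in\mathbb R^n$ and $\xi_q=(\mathbb E|z|^q)^{1/q}$ for a standard Gaussian random variable $z$. For $n\ge 1$ let $G_n$ be an $n\times n$ random matrix with i.i.d. standard Gaussian entries, let $\bar G_n=(G_n+G_n^{T})/\sqrt2=(\bar g_{ij})$, let $e_1,\dots,e_n$ be the standard basis of $\mathbb R^n$, and for $1\le i\le n$ define $v_i\in\mathbb R^n$ by $$v_i(j)=\mathrm{sgn}(\bar g_{ij})\Bigl(\frac{|\bar g_{ij}|^{p^*}}{\|\bar G_ne_i\|_{p^*}^{p^*}}\Bigr)^{1/p},\qquad 1\le j\le n,$$ where $\mathrm{sgn}(a)=1$ if $a\ge 0$ and $\mathrm{sgn}(a)=-1$ if $a<0$. Put $$\mathcal O=\Bigl\{\pm\frac{e_i+v_i}{\|e_i+v_i\|_p}:1\le i\le n\Bigr\},\qquad \mathrm{dist}(x,\mathcal O)=\min_{y\in\mathcal O}\|x-y\|_p,$$ with the convention that a vector is replaced by $0$ if its denominator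 vanishes (for $n\ge2$ this has probability $0$). **Theorem 1.3 (Stability).** Let $1<p<2$, $0<\kappa<\frac1{3p}$ and $d>0$. There exist positive constants $C_1,C_2,C_3$, depending only on $p,\kappa,d$, such that for every $n\ge1$ and every (deterministic) $\delta$ with $n^{-\kappa}\le\delta\le1$, with probability at least $1-C_3n^{-d}$ the following holds: every $x\in\mathbb R^n$ with $\|x\|_p=1$ and $\mathrm{dist}(x,\mathcal O)\ge\delta$ satisfies $$\langle G_nx,x\rangle\le 2^{\frac12-\frac2p}\bigl(1-C_1\delta^6\bigr)\,\xi_{p^*}\,n^{1/p^*}+C_2\,n^{p/(2p^*)}\sqrt{\log n}.$$ In other words, on this event every $x$ with $\|x\|_p=1$ whose value $\langle G_nx,x\rangle$ exceeds the right-hand side lies within $\ell_p$-distance less than $\delta$ of $\mathcal O$. -/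

import Mathlib

open MeasureTheory ProbabilityTheory
open scoped Matrix

namespace GaussianGrothendieck

noncomputable section

/-- The `ℓ_p`-norm `(∑ |x_i|^p)^(1/p)` of `x ∈ ℝⁿ`, for a real exponent `p ≥ 1`. -/
def ellpNorm {n : ℕ} (p : ℝ) (x : Fin n → ℝ) : ℝ :=
  (∑ i, |x i| ^ p) ^ (1 / p)

/-- `ξ_q = (𝔼 |z|^q)^(1/q)` for a standard Gaussian random variable `z`. -/
def xi (q : ℝ) : ℝ :=
  (∫ z : ℝ, |z| ^ q ∂(gaussianReal 0 1)) ^ (1 / q)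

/-- The sign with the convention that the sign of `0` is `1`. -/
def sgn (a : ℝ) : ℝ :=
  if 0 ≤ a then 1 else -1

/-- The `i`-th standard basis vector `e_i` of `ℝⁿ`. -/
def basisVec {n : ℕ} (i : Fin n) : Fin n → ℝ :=
  Pi.single i 1

/-- The symmetrized matrix `(G + Gᵀ) / √2`. -/
def symm {n : ℕ} (G : Matrix (Fin n) (Fin n) ℝ) : Matrix (Fin n) (Fin n) ℝ :=
  (1 / √2) • (G + Gᵀ)

/-- The vector `v_i ∈ ℝⁿ` built from the `i`-th column of the symmetrized matrix; here
`Real.conjExponent p = p / (p - 1)` is the Hölder conjugate `p*` of `p`. -/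
def v {n : ℕ} (p : ℝ) (G : Matrix (Fin n) (Fin n) ℝ) (i : Fin n) : Fin n → ℝ :=
  fun j => sgn (symm G i j) *
    (|symm G i j| ^ Real.conjExponent p /
      ellpNorm (Real.conjExponent p) (symm G *ᵥ basisVec i) ^ Real.conjExponent p) ^ (1 / p)

/-- The set `𝒪` of the `2n` vectors `± (e_i + v_i) / ‖e_i + v_i‖_p`. -/
def nearOptimizers {n : ℕ} (p : ℝ) (G : Matrix (Fin n) (Fin n) ℝ) : Set (Fin n → ℝ) :=
  {y | ∃ i, y = (1 / ellpNorm p (basisVec i + v p G i)) • (basisVec i + v p G i) ∨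
    y = -((1 / ellpNorm p (basisVec i + v p G i)) • (basisVec i + v p G i))}

/-- The `ℓ_p`-distance from `x` to a set `S`. -/
def ellpDist {n : ℕ} (p : ℝ) (x : Fin n → ℝ) (S : Set (Fin n → ℝ)) : ℝ :=
  sInf ((fun y => ellpNorm p (x - y)) '' S)

/-- `G` is a random `n × n` matrix with independent standard Gaussian entries. -/
def IsStdGaussianMatrix {Ω : Type*} [MeasurableSpace Ω] {n : ℕ} (P : Measure Ω)
    (G : Ω → Matrix (Fin n) (Fin n) ℝ) : Prop :=
  (∀ i j, HasLaw (fun ω => G ω i j) (gaussianReal 0 1) P) ∧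
    iIndepFun (fun (ij : Fin n × Fin n) ω => G ω ij.1 ij.2) P

end

end GaussianGrothendieck

/-!
Up to the symmetrization `Ḡ = (G + Gᵀ) / √2`, only the interaction between large and small
coordinates of `x` matters. Split a unit vector `x = y + z` at a threshold that only few coordinates
exceed: by Gaussian tail bounds, uniform over sign vectors with given supports, the
form is of error size on heavy/heavy and on light/light pairs, so `⟨G x, x⟩ ≈ √2 ⟨Ḡ y, z⟩`. Gaussian
concentration and a union bound over a net of the few possible `y` give
`‖Ḡ y‖_{p*} ≲ ‖y‖₂ ξ_{p*} n^{1/p*}`, whence `⟨G x, x⟩ ≲ √2 ‖y‖₂ ‖z‖_p ξ_{p*} n^{1/p*}`.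

Since `p < 2`, under `‖y‖_p^p + ‖z‖_p^p = 1` the product `‖y‖₂ ‖z‖_p` is near its maximum `2^{-2/p}`
only if `y` is close to a vector `± 2^{-1/p} e_i` and `‖z‖_p` to `2^{-1/p}`. Then `z` almost
saturates Hölder's inequality against row `i` of `Ḡ`, and the stability of Hölder's inequality puts
`z` close to `± 2^{-1/p} v_i`.
-/

namespace GaussianGrothendieck

section EllpNorm

variable {n : ℕ} {p q : ℝ}

lemma ellpNorm_nonneg (p : ℝ) (x : Fin n → ℝ) : 0 ≤ ellpNorm p x := by
  unfold ellpNorm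
  positivity

lemma ellpNorm_rpow (hp : 0 < p) (x : Fin n → ℝ) : ellpNorm p x ^ p = ∑ i, |x i| ^ p := by
  rw [ellpNorm, ← Real.rpow_mul (by positivity), one_div_mul_cancel hp.ne', Real.rpow_one]

lemma ellpNorm_two_sq (x : Fin n → ℝ) : ellpNorm 2 x ^ 2 = ∑ i, x i ^ 2 := by
  simpa using ellpNorm_rpow two_pos x

lemma ellpNorm_le_of_sum_le (hp : 0 < p) {x : Fin n → ℝ} {B : ℝ} (hB : 0 ≤ B)
    (h : ∑ i, |x i| ^ p ≤ B ^ p) : ellpNorm p x ≤ B := by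
  rwa [← ellpNorm_rpow hp, Real.rpow_le_rpow_iff (ellpNorm_nonneg p x) hB hp] at h

lemma ellpNorm_le_ellpNorm (hp : 0 ≤ p) {x y : Fin n → ℝ} (h : ∀ i, |x i| ≤ |y i|) :
    ellpNorm p x ≤ ellpNorm p y := by
  unfold ellpNorm
  gcongr (∑ i, ?_ ^ p) ^ (1 / p) with i
  exact h i

lemma ellpNorm_add_le (hp : 1 ≤ p) (x y : Fin n → ℝ) :
    ellpNorm p (x + y) ≤ ellpNorm p x + ellpNorm p y :=
  Real.Lp_add_le Finset.univ x y hp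

lemma ellpNorm_smul (hp : 0 < p) (c : ℝ) (x : Fin n → ℝ) :
    ellpNorm p (c • x) = |c| * ellpNorm p x := by
  simp only [ellpNorm, Pi.smul_apply, smul_eq_mul, abs_mul, Real.mul_rpow, abs_nonneg,
    ← Finset.mul_sum]
  rw [Real.mul_rpow (by positivity) (by positivity), ← Real.rpow_mul (abs_nonneg c),
    mul_one_div_cancel hp.ne', Real.rpow_one]

lemma ellpNorm_neg (p : ℝ) (x : Fin n → ℝ) : ellpNorm p (-x) = ellpNorm p x := by
  simp [ellpNorm]

lemma abs_le_ellpNorm (hp : 0 < p) (x : Fin n → ℝ) (i : Fin n) : |x i| ≤ ellpNorm p x := by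
  rw [← Real.rpow_le_rpow_iff (abs_nonneg _) (ellpNorm_nonneg p x) hp, ellpNorm_rpow hp]
  exact Finset.single_le_sum (f := fun i => |x i| ^ p) (fun _ _ => by positivity)
    (Finset.mem_univ i)

lemma ellpNorm_basisVec (hp : 0 < p) (i : Fin n) : ellpNorm p (basisVec i) = 1 := by
  have hsum : ∑ j, |basisVec i j| ^ p = 1 := by
    rw [Finset.sum_eq_single i]
    · simp [basisVec]
    · intro j _ hj
      simp [basisVec, Pi.single_eq_of_ne hj, Real.zero_rpow hp.ne']
    · simp
  rw [ellpNorm, hsum, Real.one_rpow]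

lemma ellpNorm_cons_zero (hp : p ≠ 0) (x : Fin n → ℝ) :
    ellpNorm p (Fin.cons 0 x : Fin (n + 1) → ℝ) = ellpNorm p x := by
  simp [ellpNorm, Fin.sum_univ_succ, Real.zero_rpow hp]

lemma dotProduct_le_ellpNorm_mul (h : p.HolderConjugate q) (x y : Fin n → ℝ) :
    x ⬝ᵥ y ≤ ellpNorm p x * ellpNorm q y :=
  Real.inner_le_Lp_mul_Lq _ _ _ h

lemma ellpNorm_anti (hp : 0 < p) (hpq : p ≤ q) (x : Fin n → ℝ) : ellpNorm q x ≤ ellpNorm p x := by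
  refine ellpNorm_le_of_sum_le (hp.trans_le hpq) (ellpNorm_nonneg p x) ?_
  have hsplit : ∀ {t : ℝ}, 0 ≤ t → t ^ q = t ^ (q - p) * t ^ p := fun ht => by
    rw [← Real.rpow_add_of_nonneg ht (by linarith) hp.le, sub_add_cancel]
  calc ∑ i, |x i| ^ q = ∑ i, |x i| ^ (q - p) * |x i| ^ p := by simp only [hsplit (abs_nonneg _)]
    _ ≤ ∑ i, ellpNorm p x ^ (q - p) * |x i| ^ p := by
        gcongr with i
        · exact abs_le_ellpNorm hp x i
    _ = ellpNorm p x ^ q := by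
        rw [← Finset.mul_sum, ← ellpNorm_rpow hp, ← hsplit (ellpNorm_nonneg p x)]

end EllpNorm

section GaussianConcentration

open scoped NNReal ENNReal

lemma exp_intervalIntegral_le {g : ℝ → ℝ} (hg : Continuous g) {T : ℝ} (hT : 0 < T) :
    Real.exp (∫ t in (0 : ℝ)..T, g t) ≤ T⁻¹ * ∫ t in (0 : ℝ)..T, Real.exp (T * g t) := by
  have hT' : Set.uIoc 0 T = Set.Ioc 0 T := Set.uIoc_of_le hT.le
  have hint : ∀ {h : ℝ → ℝ}, Continuous h → IntegrableOn h (Set.uIoc 0 T) := fun hh =>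
    hT' ▸ hh.integrableOn_Ioc
  have jensen := convexOn_exp.map_set_average_le (μ := volume) (t := Set.uIoc 0 T)
    (f := fun t => T * g t) Real.continuous_exp.continuousOn isClosed_univ
    (by simp [hT', hT]) (by simp [hT']) (by simp) (hint (by fun_prop)) (hint (by fun_prop))
  rw [interval_average_eq, interval_average_eq, intervalIntegral.integral_const_mul] at jensen
  simpa [hT.ne'] using jensen

section Rotation

variable {E : Type*} [NormedAddCommGroup E] [NormedSpace ℝ E] {F : E → ℝ}

lemma intervalIntegral_fderiv_rotation (hF : ContDiff ℝ 1 F) (z : E × E) :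
    ∫ θ in (0 : ℝ)..(Real.pi / 2), fderiv ℝ F (ContinuousLinearMap.rotation θ z).1
      (ContinuousLinearMap.rotation θ z).2 = F z.2 - F z.1 := by
  have hfst : ∀ θ : ℝ, HasDerivAt (fun θ => (ContinuousLinearMap.rotation θ z).1)
      (ContinuousLinearMap.rotation θ z).2 θ := fun θ => by
    simp only [ContinuousLinearMap.rotation_apply]
    exact ((Real.hasDerivAt_cos θ).smul_const z.1).add ((Real.hasDerivAt_sin θ).smul_const z.2)
  have hderiv : ∀ θ : ℝ, HasDerivAt (fun θ => F (ContinuousLinearMap.rotation θ z).1)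
      (fderiv ℝ F (ContinuousLinearMap.rotation θ z).1 (ContinuousLinearMap.rotation θ z).2) θ :=
    fun θ => HasFDerivAt.comp_hasDerivAt (f := fun θ => (ContinuousLinearMap.rotation θ z).1) θ
      ((hF.differentiable one_ne_zero) _).hasFDerivAt (hfst θ)
  have hcont : Continuous fun θ : ℝ => fderiv ℝ F (ContinuousLinearMap.rotation θ z).1
      (ContinuousLinearMap.rotation θ z).2 := by
    have := hF.continuous_fderiv one_ne_zero
    simp only [ContinuousLinearMap.rotation_apply]
    fun_prop
  rw [intervalIntegral.integral_eq_sub_of_hasDerivAt (fun θ _ => hderiv θ)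
    (hcont.intervalIntegrable _ _)]
  simp [ContinuousLinearMap.rotation_apply]

lemma ofReal_exp_sub_le_lintegral_rotation (hF : ContDiff ℝ 1 F) (c : ℝ) (z : E × E) :
    ENNReal.ofReal (Real.exp (c * (F z.2 - F z.1))) ≤ ENNReal.ofReal (Real.pi / 2)⁻¹ *
      ∫⁻ θ in Set.Ioc 0 (Real.pi / 2), ENNReal.ofReal (Real.exp (Real.pi / 2 * (c *
        fderiv ℝ F (ContinuousLinearMap.rotation θ z).1
          (ContinuousLinearMap.rotation θ z).2))) := by
  have hcont : Continuous fun θ : ℝ => c * fderiv ℝ F (ContinuousLinearMap.rotation θ z).1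
      (ContinuousLinearMap.rotation θ z).2 := by
    have := hF.continuous_fderiv one_ne_zero
    simp only [ContinuousLinearMap.rotation_apply]
    fun_prop
  have hpi : 0 < Real.pi / 2 := by positivity
  have jensen := exp_intervalIntegral_le hcont hpi
  rw [intervalIntegral.integral_const_mul, intervalIntegral_fderiv_rotation hF] at jensen
  rw [← ofReal_integral_eq_lintegral_ofReal
      (Continuous.integrableOn_Ioc (by fun_prop)) (ae_of_all _ fun _ => (Real.exp_pos _).le),
    ← ENNReal.ofReal_mul (by positivity), ← intervalIntegral.integral_of_le hpi.le]
  exact ENNReal.ofReal_le_ofReal jensen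

end Rotation

variable {E : Type*} [NormedAddCommGroup E] [InnerProductSpace ℝ E] [FiniteDimensional ℝ E]
  [MeasurableSpace E] [BorelSpace E]

lemma map_dual_stdGaussian (L : StrongDual ℝ E) :
    (stdGaussian E).map L = gaussianReal 0 (‖L‖₊ ^ 2) := by
  rw [IsGaussian.map_eq_gaussianReal, integral_strongDual_stdGaussian, variance_dual_stdGaussian]
  congr 1
  ext
  simp

lemma hasSubgaussianMGF_dual_stdGaussian (L : StrongDual ℝ E) :
    HasSubgaussianMGF L (‖L‖₊ ^ 2) (stdGaussian E) where
  integrable_exp_mul t := by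
    have h := integrable_exp_mul_gaussianReal (μ := 0) (v := ‖L‖₊ ^ 2) t
    rw [← map_dual_stdGaussian L] at h
    exact h.comp_measurable L.measurable
  mgf_le t := by simp [mgf_gaussianReal (map_dual_stdGaussian L)]

variable {F : E → ℝ}

lemma lintegral_exp_fderiv_le (hF : ContDiff ℝ 1 F) (hL : ∀ x, ‖fderiv ℝ F x‖ ≤ 1) (s : ℝ) :
    ∫⁻ z : E × E, ENNReal.ofReal (Real.exp (s * fderiv ℝ F z.1 z.2))
      ∂(stdGaussian E).prod (stdGaussian E) ≤ ENNReal.ofReal (Real.exp (s ^ 2 / 2)) := by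
  have := hF.continuous_fderiv one_ne_zero
  have hfiber : ∀ x, ∫⁻ y, ENNReal.ofReal (Real.exp (s * fderiv ℝ F x y)) ∂stdGaussian E ≤
      ENNReal.ofReal (Real.exp (s ^ 2 / 2)) := by
    intro x
    have hsub := hasSubgaussianMGF_dual_stdGaussian (fderiv ℝ F x)
    rw [← ofReal_integral_eq_lintegral_ofReal (hsub.integrable_exp_mul s)
      (ae_of_all _ fun _ => (Real.exp_pos _).le)]
    refine ENNReal.ofReal_le_ofReal ((hsub.mgf_le s).trans (Real.exp_le_exp.2 ?_))
    have : ‖fderiv ℝ F x‖ ^ 2 ≤ 1 := pow_le_one₀ (norm_nonneg _) (hL x)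
    simpa using div_le_div_of_nonneg_right (mul_le_of_le_one_left (sq_nonneg s) this) zero_le_two
  rw [lintegral_prod _ (Measurable.aemeasurable (by fun_prop))]
  exact (lintegral_mono hfiber).trans_eq (by simp)

/-- The Maurey–Pisier bound: the path `θ ↦ cos θ • x + sin θ • y` from `x` to `y` and its velocity
are, at every time, again a pair of independent standard Gaussian vectors. -/
lemma lintegral_exp_sub_le (hF : ContDiff ℝ 1 F) (hL : ∀ x, ‖fderiv ℝ F x‖ ≤ 1) (c : ℝ) :
    ∫⁻ z, ENNReal.ofReal (Real.exp (c * (F z.2 - F z.1))) ∂(stdGaussian E).prod (stdGaussian E)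
      ≤ ENNReal.ofReal (Real.exp (Real.pi ^ 2 * c ^ 2 / 8)) := by
  have := hF.continuous_fderiv one_ne_zero
  set μ := (stdGaussian E).prod (stdGaussian E)
  let φ : E × E → ℝ≥0∞ := fun z =>
    ENNReal.ofReal (Real.exp (Real.pi / 2 * (c * fderiv ℝ F z.1 z.2)))
  have hφ : Measurable φ := by fun_prop
  have hrotation : ∀ θ, ∫⁻ z, φ (ContinuousLinearMap.rotation θ z) ∂μ ≤
      ENNReal.ofReal (Real.exp (Real.pi ^ 2 * c ^ 2 / 8)) := by
    intro θ
    rw [← lintegral_map hφ (by fun_prop), IsGaussian.map_rotation_eq_self (by simp)]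
    convert lintegral_exp_fderiv_le hF hL (Real.pi / 2 * c) using 3
    · simp only [φ, mul_assoc]
    · ring
  have hmeas : Measurable fun w : (E × E) × ℝ => φ (ContinuousLinearMap.rotation w.2 w.1) := by
    simp only [ContinuousLinearMap.rotation_apply]
    fun_prop
  calc ∫⁻ z, ENNReal.ofReal (Real.exp (c * (F z.2 - F z.1))) ∂μ
      ≤ ∫⁻ z, (ENNReal.ofReal (Real.pi / 2)⁻¹ *
          ∫⁻ θ in Set.Ioc 0 (Real.pi / 2), φ (ContinuousLinearMap.rotation θ z)) ∂μ :=
        lintegral_mono fun z => ofReal_exp_sub_le_lintegral_rotation hF c z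
    _ = ENNReal.ofReal (Real.pi / 2)⁻¹ *
          ∫⁻ θ in Set.Ioc 0 (Real.pi / 2), ∫⁻ z, φ (ContinuousLinearMap.rotation θ z) ∂μ := by
        rw [lintegral_const_mul' _ _ ENNReal.ofReal_ne_top,
          lintegral_lintegral_swap hmeas.aemeasurable]
    _ ≤ ENNReal.ofReal (Real.pi / 2)⁻¹ * ∫⁻ _ in Set.Ioc (0 : ℝ) (Real.pi / 2),
          ENNReal.ofReal (Real.exp (Real.pi ^ 2 * c ^ 2 / 8)) := by
        gcongr with θ
        exact hrotation θ
    _ = ENNReal.ofReal (Real.exp (Real.pi ^ 2 * c ^ 2 / 8)) := by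
        rw [setLIntegral_const, Real.volume_Ioc, sub_zero, mul_left_comm,
          ← ENNReal.ofReal_mul (by positivity), inv_mul_cancel₀ (by positivity)]
        simp

lemma lintegral_exp_mul_lintegral_exp_neg_le (hF : ContDiff ℝ 1 F)
    (hL : ∀ x, ‖fderiv ℝ F x‖ ≤ 1) (c : ℝ) :
    (∫⁻ x, ENNReal.ofReal (Real.exp (-c * F x)) ∂stdGaussian E) *
        ∫⁻ x, ENNReal.ofReal (Real.exp (c * F x)) ∂stdGaussian E
      ≤ ENNReal.ofReal (Real.exp (Real.pi ^ 2 * c ^ 2 / 8)) := by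
  have := hF.continuous
  rw [← lintegral_prod_mul (by fun_prop) (by fun_prop)]
  refine (lintegral_mono fun z => le_of_eq ?_).trans (lintegral_exp_sub_le hF hL c)
  rw [← ENNReal.ofReal_mul (Real.exp_pos _).le, ← Real.exp_add]
  ring_nf

lemma integrable_exp_mul_stdGaussian (hF : ContDiff ℝ 1 F) (hL : ∀ x, ‖fderiv ℝ F x‖ ≤ 1)
    (c : ℝ) : Integrable (fun x => Real.exp (c * F x)) (stdGaussian E) := by
  have := hF.continuous
  rw [← lintegral_ofReal_ne_top_iff_integrable (by fun_prop)
    (ae_of_all _ fun _ => (Real.exp_pos _).le)]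
  intro htop
  have hbound := lintegral_exp_mul_lintegral_exp_neg_le hF hL c
  rw [htop, ENNReal.mul_top] at hbound
  · exact ENNReal.ofReal_ne_top (top_le_iff.1 hbound)
  · rw [Ne, lintegral_eq_zero_iff (by fun_prop)]
    intro hzero
    obtain ⟨x, hx⟩ := hzero.exists
    exact (Real.exp_pos _).not_ge (ENNReal.ofReal_eq_zero.1 hx)

lemma mgf_neg_mul_mgf_le (hF : ContDiff ℝ 1 F) (hL : ∀ x, ‖fderiv ℝ F x‖ ≤ 1) (c : ℝ) :
    mgf F (stdGaussian E) (-c) * mgf F (stdGaussian E) c ≤ Real.exp (Real.pi ^ 2 * c ^ 2 / 8) := by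
  have hbound := lintegral_exp_mul_lintegral_exp_neg_le hF hL c
  rw [← ofReal_integral_eq_lintegral_ofReal (integrable_exp_mul_stdGaussian hF hL _)
      (ae_of_all _ fun _ => (Real.exp_pos _).le),
    ← ofReal_integral_eq_lintegral_ofReal (integrable_exp_mul_stdGaussian hF hL _)
      (ae_of_all _ fun _ => (Real.exp_pos _).le),
    ← ENNReal.ofReal_mul (integral_nonneg fun _ => (Real.exp_pos _).le)] at hbound
  exact (ENNReal.ofReal_le_ofReal_iff (Real.exp_pos _).le).1 hbound

lemma hasSubgaussianMGF_sub_integral_stdGaussian (hF : ContDiff ℝ 1 F)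
    (hL : ∀ x, ‖fderiv ℝ F x‖ ≤ 1) :
    HasSubgaussianMGF (fun x => F x - ∫ y, F y ∂stdGaussian E) (NNReal.pi ^ 2 / 4)
      (stdGaussian E) := by
  have hexp := integrable_exp_mul_stdGaussian hF hL
  have hint : Integrable F (stdGaussian E) :=
    integrable_of_mem_interior_integrableExpSet (by simp [integrableExpSet, hexp])
  have hsplit : ∀ t x, Real.exp (t * (F x - ∫ y, F y ∂stdGaussian E)) =
      Real.exp (-t * ∫ y, F y ∂stdGaussian E) * Real.exp (t * F x) := fun t x => by
    rw [← Real.exp_add]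
    ring_nf
  refine ⟨fun t => by simpa only [hsplit] using (hexp t).const_mul _, fun t => ?_⟩
  have jensen : Real.exp (-t * ∫ y, F y ∂stdGaussian E) ≤ mgf F (stdGaussian E) (-t) := by
    rw [← integral_const_mul]
    exact convexOn_exp.map_integral_le Real.continuous_exp.continuousOn isClosed_univ (by simp)
      (hint.const_mul _) (hexp (-t))
  calc mgf (fun x => F x - ∫ y, F y ∂stdGaussian E) (stdGaussian E) t
      = Real.exp (-t * ∫ y, F y ∂stdGaussian E) * mgf F (stdGaussian E) t := by
        simp only [mgf, hsplit, integral_const_mul]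
    _ ≤ mgf F (stdGaussian E) (-t) * mgf F (stdGaussian E) t := by
        gcongr
        exact mgf_nonneg
    _ ≤ Real.exp (Real.pi ^ 2 * t ^ 2 / 8) := mgf_neg_mul_mgf_le hF hL t
    _ = Real.exp ((NNReal.pi ^ 2 / 4 : ℝ≥0) * t ^ 2 / 2) := by
        congr 1
        push_cast
        rw [NNReal.coe_real_pi]
        ring

end GaussianConcentration

section NormConcentration

open scoped NNReal ENNReal

lemma xi_nonneg (q : ℝ) : 0 ≤ xi q :=
  Real.rpow_nonneg (integral_nonneg fun _ => by positivity) _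

lemma xi_rpow {q : ℝ} (hq : q ≠ 0) : xi q ^ q = ∫ z : ℝ, |z| ^ q ∂gaussianReal 0 1 := by
  rw [xi, ← Real.rpow_mul (integral_nonneg fun _ => by positivity), one_div_mul_cancel hq,
    Real.rpow_one]

lemma xi_mul_rpow_card {n : ℕ} {q : ℝ} (hq : q ≠ 0) :
    (xi q * (n : ℝ) ^ (1 / q)) ^ q = n * xi q ^ q := by
  rw [Real.mul_rpow (xi_nonneg q) (by positivity), ← Real.rpow_mul (by positivity),
    one_div_mul_cancel hq, Real.rpow_one, mul_comm]

lemma integrable_abs_rpow_dual {F : Type*} [NormedAddCommGroup F] [NormedSpace ℝ F]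
    [CompleteSpace F] [SecondCountableTopology F] [MeasurableSpace F] [BorelSpace F] {q : ℝ}
    (hq : 0 < q) (μ : Measure F) [IsGaussian μ] (L : StrongDual ℝ F) :
    Integrable (fun x => |L x| ^ q) μ := by
  have h := (IsGaussian.memLp_dual μ L (ENNReal.ofReal q)
    ENNReal.ofReal_ne_top).integrable_norm_rpow (by simpa using hq) ENNReal.ofReal_ne_top
  simpa [ENNReal.toReal_ofReal hq.le] using h

lemma xi_pos {q : ℝ} (hq : 0 < q) : 0 < xi q := by
  refine Real.rpow_pos_of_pos ?_ _
  have hint : Integrable (fun z : ℝ => |z| ^ q) (gaussianReal 0 1) :=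
    integrable_abs_rpow_dual hq _ (.id ℝ ℝ)
  rw [integral_pos_iff_support_of_nonneg (fun z => by positivity) hint]
  have hsupp : Function.support (fun z : ℝ => |z| ^ q) = {0}ᶜ := by
    ext z
    simp [Real.rpow_eq_zero (abs_nonneg z) hq.ne']
  have := nullSingletonClass_gaussianReal (μ := 0) (v := 1) one_ne_zero
  rw [hsupp, prob_compl_eq_one_sub (measurableSet_singleton 0)]
  simp

variable {E : Type*} [NormedAddCommGroup E] [InnerProductSpace ℝ E] {n : ℕ} {q : ℝ}

/-- The smooth approximation `x ↦ (1 + ∑ |L_j x| ^ q) ^ (1 / q)` of the `ℓ_q`-norm of `L x`,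
encoded as the norm of `L x` with an extra coordinate `1`. -/
noncomputable def smoothNorm (q : ℝ) (L : Fin n → StrongDual ℝ E) (x : E) : ℝ :=
  ellpNorm q (Fin.cons 1 (fun j => L j x) : Fin (n + 1) → ℝ)

lemma smoothNorm_eq (q : ℝ) (L : Fin n → StrongDual ℝ E) (x : E) :
    smoothNorm q L x = (1 + ∑ j, |L j x| ^ q) ^ (1 / q) := by
  simp [smoothNorm, ellpNorm, Fin.sum_univ_succ]

lemma ellpNorm_le_smoothNorm (hq : 0 < q) (L : Fin n → StrongDual ℝ E) (x : E) :
    ellpNorm q (fun j => L j x) ≤ smoothNorm q L x := by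
  rw [smoothNorm_eq, ellpNorm]
  gcongr
  exact le_add_of_nonneg_left zero_le_one

lemma contDiff_smoothNorm (hq : 1 < q) (L : Fin n → StrongDual ℝ E) :
    ContDiff ℝ 1 (smoothNorm q L) := by
  have hsum : ContDiff ℝ 1 fun x => 1 + ∑ j, |L j x| ^ q :=
    contDiff_const.add (ContDiff.sum fun j _ => by simpa using (L j).contDiff.norm_rpow hq)
  rw [funext (smoothNorm_eq q L)]
  exact hsum.rpow_const_of_ne fun x => by positivity

lemma lipschitzWith_smoothNorm (hq : 2 ≤ q) (L : Fin n → StrongDual ℝ E)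
    (hL : ∀ x, ∑ j, L j x ^ 2 ≤ ‖x‖ ^ 2) : LipschitzWith 1 (smoothNorm q L) := by
  refine LipschitzWith.of_le_add fun x y => ?_
  have hcons : (Fin.cons 1 (fun j => L j x) : Fin (n + 1) → ℝ) =
      Fin.cons 1 (fun j => L j y) + Fin.cons 0 (fun j => L j (x - y)) := by
    ext i
    cases i using Fin.cases <;> simp
  calc smoothNorm q L x
      ≤ smoothNorm q L y + ellpNorm q (Fin.cons 0 fun j => L j (x - y) : Fin (n + 1) → ℝ) := by
        rw [smoothNorm, hcons]
        exact ellpNorm_add_le (by linarith) _ _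
    _ ≤ smoothNorm q L y + ellpNorm 2 (fun j => L j (x - y)) := by
        rw [ellpNorm_cons_zero (by linarith)]
        gcongr
        exact ellpNorm_anti two_pos hq _
    _ ≤ smoothNorm q L y + dist x y := by
        gcongr
        rw [dist_eq_norm]
        refine le_of_sq_le_sq ?_ (norm_nonneg _)
        rw [ellpNorm_two_sq]
        exact hL _

lemma norm_le_one_of_sum_sq_le {L : Fin n → StrongDual ℝ E}
    (hL : ∀ x, ∑ j, L j x ^ 2 ≤ ‖x‖ ^ 2) (j : Fin n) : ‖L j‖ ≤ 1 := by
  refine (L j).opNorm_le_bound zero_le_one fun x => ?_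
  rw [one_mul]
  exact abs_le_of_sq_le_sq ((Finset.single_le_sum (f := fun j => L j x ^ 2)
    (fun _ _ => sq_nonneg _) (Finset.mem_univ j)).trans (hL x)) (norm_nonneg _)

variable [FiniteDimensional ℝ E] [MeasurableSpace E] [BorelSpace E]

lemma integral_abs_rpow_dual_stdGaussian (hq : 0 < q) (L : StrongDual ℝ E) :
    ∫ x, |L x| ^ q ∂stdGaussian E = ‖L‖ ^ q * xi q ^ q := by
  have hscale : (stdGaussian E).map L = (gaussianReal 0 1).map (‖L‖ * ·) := by
    rw [map_dual_stdGaussian, gaussianReal_map_const_mul]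
    congr 1
    · simp
    · ext; simp
  have hpush := integral_map (μ := stdGaussian E) (φ := L) (f := fun z : ℝ => |z| ^ q)
    (by fun_prop) (by fun_prop (disch := exact hq.le))
  rw [← hpush, hscale, integral_map (by fun_prop) (by fun_prop (disch := exact hq.le))]
  simp only [abs_mul, abs_norm, Real.mul_rpow (norm_nonneg L) (abs_nonneg _), integral_const_mul,
    xi_rpow hq.ne']

lemma integral_sum_abs_rpow_le (hq : 0 < q) {L : Fin n → StrongDual ℝ E}
    (hL : ∀ j, ‖L j‖ ≤ 1) : ∫ x, ∑ j, |L j x| ^ q ∂stdGaussian E ≤ n * xi q ^ q := by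
  have hξ := xi_nonneg q
  rw [integral_finsetSum _ fun j _ => integrable_abs_rpow_dual hq _ (L j)]
  calc ∑ j, ∫ x, |L j x| ^ q ∂stdGaussian E = ∑ j, ‖L j‖ ^ q * xi q ^ q := by
        simp only [integral_abs_rpow_dual_stdGaussian hq]
    _ ≤ ∑ _j : Fin n, 1 * xi q ^ q := by
        gcongr with j
        exact Real.rpow_le_one (norm_nonneg _) (hL j) hq.le
    _ = n * xi q ^ q := by simp

lemma integral_smoothNorm_le (hq : 2 ≤ q) {L : Fin n → StrongDual ℝ E} (hL : ∀ j, ‖L j‖ ≤ 1) :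
    ∫ x, smoothNorm q L x ∂stdGaussian E ≤ xi q * (n : ℝ) ^ (1 / q) + 1 := by
  have hq0 : 0 < q := by linarith
  have hq1 : 1 / q ≤ 1 := (div_le_one hq0).2 (by linarith)
  have hξ := xi_nonneg q
  have hsum : Integrable (fun x => ∑ j, |L j x| ^ q) (stdGaussian E) :=
    integrable_finsetSum _ fun j _ => integrable_abs_rpow_dual hq0 _ (L j)
  have hint : Integrable (fun x => 1 + ∑ j, |L j x| ^ q) (stdGaussian E) :=
    (integrable_const 1).add hsum
  have hintF : Integrable (smoothNorm q L) (stdGaussian E) := by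
    refine hint.mono' (contDiff_smoothNorm (by linarith) L).continuous.aestronglyMeasurable
      (ae_of_all _ fun x => ?_)
    rw [smoothNorm_eq, Real.norm_of_nonneg (by positivity)]
    exact Real.rpow_le_self_of_one_le (le_add_of_nonneg_right (by positivity)) hq1
  have hmoment : ∫ x, 1 + ∑ j, |L j x| ^ q ∂stdGaussian E ≤ 1 + n * xi q ^ q := by
    rw [integral_add (integrable_const _) hsum]
    simpa using integral_sum_abs_rpow_le hq0 hL
  calc ∫ x, smoothNorm q L x ∂stdGaussian E
      ≤ (∫ x, 1 + ∑ j, |L j x| ^ q ∂stdGaussian E) ^ (1 / q) := by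
        simp only [funext (smoothNorm_eq q L)] at hintF ⊢
        exact (Real.concaveOn_rpow (by positivity) hq1).le_map_integral
          (Real.continuous_rpow_const (by positivity)).continuousOn isClosed_Ici
          (ae_of_all _ fun x => Set.mem_Ici.2 (by positivity)) hint hintF
    _ ≤ (1 + n * xi q ^ q) ^ (1 / q) := by
        gcongr
    _ ≤ 1 ^ (1 / q) + (n * xi q ^ q) ^ (1 / q) :=
        Real.rpow_add_le_add_rpow zero_le_one (by positivity) (by positivity) hq1
    _ = xi q * (n : ℝ) ^ (1 / q) + 1 := by
        rw [Real.one_rpow, ← xi_mul_rpow_card hq0.ne', ← Real.rpow_mul (by positivity),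
          mul_one_div_cancel hq0.ne', Real.rpow_one, add_comm]

lemma measureReal_ellpNorm_ge_le (hq : 2 ≤ q) (L : Fin n → StrongDual ℝ E)
    (hL : ∀ x, ∑ j, L j x ^ 2 ≤ ‖x‖ ^ 2) {r : ℝ} (hr : 0 ≤ r) :
    (stdGaussian E).real
        {x | xi q * (n : ℝ) ^ (1 / q) + 1 + r ≤ ellpNorm q (fun j => L j x)} ≤
      Real.exp (-(2 * r ^ 2 / Real.pi ^ 2)) := by
  have hsub := hasSubgaussianMGF_sub_integral_stdGaussian
    (contDiff_smoothNorm (one_lt_two.trans_le hq) L)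
    fun x => by
      simpa using norm_fderiv_le_of_lipschitz ℝ (lipschitzWith_smoothNorm hq L hL) (x₀ := x)
  calc (stdGaussian E).real {x | xi q * (n : ℝ) ^ (1 / q) + 1 + r ≤ ellpNorm q (fun j => L j x)}
      ≤ (stdGaussian E).real
          {x | r ≤ smoothNorm q L x - ∫ y, smoothNorm q L y ∂stdGaussian E} := by
        refine measureReal_mono fun x hx => ?_
        have := integral_smoothNorm_le hq (norm_le_one_of_sum_sq_le hL)
        have := ellpNorm_le_smoothNorm (two_pos.trans_le hq) L x
        simp only [Set.mem_ofPred_eq] at hx ⊢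
        linarith
    _ ≤ Real.exp (-r ^ 2 / (2 * (NNReal.pi ^ 2 / 4 : ℝ≥0))) := hsub.measure_ge_le hr
    _ = Real.exp (-(2 * r ^ 2 / Real.pi ^ 2)) := by
        congr 1
        push_cast
        rw [NNReal.coe_real_pi]
        field_simp
        ring

end NormConcentration

section TypicalMatrices

variable {n : ℕ}

/-- Uniform bound on the bilinear form of `G` over pairs of sign vectors, of the size predicted by a
union bound over Gaussian tails. -/
def SignBound (K : ℝ) (G : Matrix (Fin n) (Fin n) ℝ) : Prop :=
  ∀ f g : Fin n → SignType, (fun i => (f i : ℝ)) ⬝ᵥ G *ᵥ (fun i => (g i : ℝ)) ≤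
    K * √(Real.log n) * (hammingNorm f * √(hammingNorm g) + hammingNorm g * √(hammingNorm f))

/-- Uniform bound on the `ℓ_q`-norm of the symmetrized matrix applied to integer vectors `m` with
entries at most `n ^ 2`. Only the coordinates outside the support of `m` are kept, where the
entries of `symm G` involved are independent. -/
def ColumnBound (q K : ℝ) (G : Matrix (Fin n) (Fin n) ℝ) : Prop :=
  ∀ m : Fin n → ℤ, (∀ i, |m i| ≤ n ^ 2) →
    ellpNorm q ({j | m j = 0}.indicator ((fun i => (m i : ℝ)) ᵥ* symm G)) ≤
      ellpNorm 2 (fun i => (m i : ℝ)) *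
        (xi q * (n : ℝ) ^ (1 / q) + K * √(hammingNorm m) * √(Real.log n))

lemma sum_pow_hammingNorm {ι α : Type*} [Fintype ι] [DecidableEq ι] [Zero α] [DecidableEq α]
    {s : Finset α} (hs : 0 ∈ s) (t : ℝ) :
    ∑ f ∈ Fintype.piFinset (fun _ : ι => s), t ^ hammingNorm f =
      (1 + (s.card - 1) * t) ^ Fintype.card ι := by
  have hprod (f : ι → α) : t ^ hammingNorm f = ∏ i, if f i ≠ 0 then t else 1 := by
    rw [hammingNorm, Finset.prod_ite, Finset.prod_const, Finset.prod_const_one, mul_one]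
  have hsum : ∑ k ∈ s, (if k ≠ 0 then t else 1) = 1 + (s.card - 1) * t := by
    rw [← Finset.add_sum_erase _ _ hs, Finset.sum_congr rfl (g := fun _ => t)
      (fun x hx => if_pos (Finset.ne_of_mem_erase hx)), Finset.sum_const, nsmul_eq_mul,
      Finset.cast_card_erase_of_mem hs, if_neg (not_not.2 rfl)]
  simp_rw [hprod]
  rw [← Finset.prod_univ_sum (fun _ : ι => s) (fun _ k => if k ≠ 0 then t else 1), hsum,
    Finset.prod_const, Finset.card_univ]

lemma exp_neg_add_mul_log (hn : 1 ≤ n) (d : ℝ) (k : ℕ) :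
    Real.exp (-((d + k) * Real.log n)) = (n : ℝ) ^ (-d) * (n : ℝ)⁻¹ ^ k := by
  have hn0 : (0 : ℝ) < n := by positivity
  rw [inv_pow, ← Real.rpow_natCast, ← Real.rpow_neg hn0.le, ← Real.rpow_add hn0,
    Real.rpow_def_of_pos hn0]
  congr 1
  ring

lemma one_add_div_pow_le_exp {c : ℝ} (hc : 0 ≤ c) : (1 + c / n) ^ n ≤ Real.exp c := by
  rcases n.eq_zero_or_pos with rfl | hn
  · simpa using hc
  calc (1 + c / n) ^ n ≤ Real.exp (c / n) ^ n := by
        gcongr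
        linarith [Real.add_one_le_exp (c / n)]
    _ = Real.exp c := by
        rw [← Real.exp_nat_mul]
        congr 1
        field_simp

lemma sq_ellpNorm_two_sign (f : Fin n → SignType) :
    ellpNorm 2 (fun i => (f i : ℝ)) ^ 2 = hammingNorm f := by
  rw [ellpNorm_two_sq, hammingNorm, Finset.card_filter, Nat.cast_sum]
  refine Finset.sum_congr rfl fun i _ => ?_
  cases f i <;> simp

/-- The Euclidean space of `n × n` matrices, carrying the standard Gaussian measure. -/
abbrev MatSpace (n : ℕ) := EuclideanSpace ℝ (Fin n × Fin n)

/-- The matrix with the coordinates of a point of `MatSpace n`. -/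
def toMat (x : MatSpace n) : Matrix (Fin n) (Fin n) ℝ := Matrix.of fun i j => x (i, j)

lemma symm_toMat_apply (x : MatSpace n) (i j : Fin n) :
    symm (toMat x) i j = 1 / √2 * (x (i, j) + x (j, i)) := rfl

lemma measureReal_dotProduct_mulVec_ge_le (u w : Fin n → ℝ) {t : ℝ} (ht : 0 ≤ t) :
    (stdGaussian (MatSpace n)).real {x | t ≤ u ⬝ᵥ toMat x *ᵥ w} ≤
      Real.exp (-t ^ 2 / (2 * (ellpNorm 2 u ^ 2 * ellpNorm 2 w ^ 2))) := by
  set L : StrongDual ℝ (MatSpace n) :=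
    innerSL ℝ (WithLp.toLp 2 fun ij : Fin n × Fin n => u ij.1 * w ij.2)
  have hL (x : MatSpace n) : L x = u ⬝ᵥ toMat x *ᵥ w := by
    simp only [L, innerSL_apply_apply, PiLp.inner_apply, dotProduct, Matrix.mulVec, toMat,
      Fintype.sum_prod_type, Finset.mul_sum, Matrix.of_apply]
    refine Finset.sum_congr rfl fun i _ => Finset.sum_congr rfl fun j _ => ?_
    simp only [RCLike.inner_apply, conj_trivial]
    ring
  have hnorm : ‖L‖ ^ 2 = ellpNorm 2 u ^ 2 * ellpNorm 2 w ^ 2 := by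
    simp only [L, innerSL_apply_norm, EuclideanSpace.real_norm_sq_eq, Fintype.sum_prod_type,
      mul_pow, ellpNorm_two_sq, Finset.sum_mul_sum]
  have htail := (hasSubgaussianMGF_dual_stdGaussian L).measure_ge_le ht
  simpa only [hL, NNReal.coe_pow, coe_nnnorm, hnorm] using htail

lemma mul_log_le_sq_div {a b d K : ℝ} (ha : 1 ≤ a) (hb : 1 ≤ b) (hd : 0 ≤ d)
    (hK : d + 1 ≤ K ^ 2 / 2) :
    (d + (a + b)) * Real.log n ≤
      (K * √(Real.log n) * (a * √b + b * √a)) ^ 2 / (2 * (a * b)) := by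
  have hlog : 0 ≤ Real.log n := Real.log_natCast_nonneg n
  have hsq : a * b * (a + b) ≤ (a * √b + b * √a) ^ 2 := by
    have hcross : 0 ≤ 2 * (a * √b) * (b * √a) := by positivity
    calc a * b * (a + b) = a ^ 2 * √b ^ 2 + b ^ 2 * √a ^ 2 := by
          rw [Real.sq_sqrt (by positivity), Real.sq_sqrt (by positivity)]
          ring
      _ ≤ (a * √b + b * √a) ^ 2 := by nlinarith
  have hdK : d + (a + b) ≤ K ^ 2 / 2 * (a + b) := by nlinarith
  rw [le_div_iff₀ (by positivity)]
  calc (d + (a + b)) * Real.log n * (2 * (a * b))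
      ≤ K ^ 2 / 2 * (a + b) * Real.log n * (2 * (a * b)) := by gcongr
    _ = K ^ 2 * Real.log n * (a * b * (a + b)) := by ring
    _ ≤ K ^ 2 * Real.log n * (a * √b + b * √a) ^ 2 := by gcongr
    _ = (K * √(Real.log n) * (a * √b + b * √a)) ^ 2 := by
        rw [mul_pow, mul_pow, Real.sq_sqrt hlog]

lemma measureReal_sign_form_gt_le (hn : 1 ≤ n) {d K : ℝ} (hd : 0 ≤ d) (hK0 : 0 ≤ K)
    (hK : d + 1 ≤ K ^ 2 / 2) (f g : Fin n → SignType) :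
    (stdGaussian (MatSpace n)).real {x | K * √(Real.log n) *
        (hammingNorm f * √(hammingNorm g) + hammingNorm g * √(hammingNorm f)) <
          (fun i => (f i : ℝ)) ⬝ᵥ toMat x *ᵥ (fun i => (g i : ℝ))} ≤
      (n : ℝ) ^ (-d) * ((n : ℝ)⁻¹ ^ hammingNorm f * (n : ℝ)⁻¹ ^ hammingNorm g) := by
  rcases eq_or_ne f 0 with rfl | hf
  · exact (by simp [← Pi.zero_def] : _ = (0 : ℝ)).trans_le (by positivity)
  rcases eq_or_ne g 0 with rfl | hg
  · exact (by simp [← Pi.zero_def] : _ = (0 : ℝ)).trans_le (by positivity)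
  have hf1 : (1 : ℝ) ≤ hammingNorm f := by exact_mod_cast hammingNorm_pos_iff.2 hf
  have hg1 : (1 : ℝ) ≤ hammingNorm g := by exact_mod_cast hammingNorm_pos_iff.2 hg
  set t := K * √(Real.log n) *
    (hammingNorm f * √(hammingNorm g) + hammingNorm g * √(hammingNorm f))
  have ht0 : 0 ≤ t := by positivity
  refine (measureReal_mono (fun x hx => ?_) (measure_ne_top _ _)).trans
    ((measureReal_dotProduct_mulVec_ge_le (fun i => (f i : ℝ)) (fun i => (g i : ℝ)) ht0).trans ?_)
  · exact (show t < _ from hx).le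
  rw [← pow_add, ← exp_neg_add_mul_log hn, sq_ellpNorm_two_sign, sq_ellpNorm_two_sign, neg_div,
    Nat.cast_add]
  gcongr
  exact mul_log_le_sq_div hf1 hg1 hd hK

lemma measureReal_not_signBound_le (hn : 1 ≤ n) {d K : ℝ} (hd : 0 ≤ d) (hK0 : 0 ≤ K)
    (hK : d + 1 ≤ K ^ 2 / 2) :
    (stdGaussian (MatSpace n)).real {x | ¬ SignBound K (toMat x)} ≤
      Real.exp 4 * (n : ℝ) ^ (-d) := by
  have hsum : ∑ f : Fin n → SignType, (n : ℝ)⁻¹ ^ hammingNorm f ≤ Real.exp 2 := by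
    have h := sum_pow_hammingNorm (ι := Fin n) (Finset.mem_univ (0 : SignType)) (n : ℝ)⁻¹
    rw [Fintype.piFinset_univ] at h
    rw [h, Fintype.card_fin]
    refine le_trans (le_of_eq ?_) (one_add_div_pow_le_exp (n := n) zero_le_two)
    rw [show (Finset.univ : Finset SignType).card = 3 from rfl]
    norm_num [div_eq_mul_inv]
  calc (stdGaussian (MatSpace n)).real {x | ¬ SignBound K (toMat x)}
      ≤ (stdGaussian (MatSpace n)).real (⋃ fg ∈ (Finset.univ :
          Finset ((Fin n → SignType) × (Fin n → SignType))), {x | K * √(Real.log n) *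
        (hammingNorm fg.1 * √(hammingNorm fg.2) + hammingNorm fg.2 * √(hammingNorm fg.1)) <
          (fun i => (fg.1 i : ℝ)) ⬝ᵥ toMat x *ᵥ (fun i => (fg.2 i : ℝ))}) := by
        refine measureReal_mono (fun x hx => ?_) (measure_ne_top _ _)
        simpa [SignBound] using hx
    _ ≤ ∑ fg : (Fin n → SignType) × (Fin n → SignType),
          (n : ℝ) ^ (-d) * ((n : ℝ)⁻¹ ^ hammingNorm fg.1 * (n : ℝ)⁻¹ ^ hammingNorm fg.2) :=
        (measureReal_biUnion_finset_le _ _).trans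
          (Finset.sum_le_sum fun fg _ => measureReal_sign_form_gt_le hn hd hK0 hK fg.1 fg.2)
    _ = (n : ℝ) ^ (-d) * ((∑ f : Fin n → SignType, (n : ℝ)⁻¹ ^ hammingNorm f) *
          ∑ g : Fin n → SignType, (n : ℝ)⁻¹ ^ hammingNorm g) := by
        rw [← Finset.mul_sum, Fintype.sum_prod_type, Finset.sum_mul_sum]
    _ ≤ (n : ℝ) ^ (-d) * (Real.exp 2 * Real.exp 2) := by gcongr
    _ = Real.exp 4 * (n : ℝ) ^ (-d) := by
        rw [← Real.exp_add]
        norm_num [mul_comm]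

lemma sum_sq_indicator_vecMul_symm_le (u : Fin n → ℝ) (x : MatSpace n) :
    ∑ j, {j | u j = 0}.indicator (u ᵥ* symm (toMat x)) j ^ 2 ≤ ellpNorm 2 u ^ 2 * ‖x‖ ^ 2 := by
  classical
  have hsymm (i j : Fin n) : symm (toMat x) i j ^ 2 ≤ x (i, j) ^ 2 + x (j, i) ^ 2 := by
    rw [symm_toMat_apply, mul_pow, div_pow, Real.sq_sqrt zero_le_two]
    nlinarith [sq_nonneg (x (i, j) - x (j, i))]
  have hcs (j : Fin n) : {j | u j = 0}.indicator (u ᵥ* symm (toMat x)) j ^ 2 ≤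
      ellpNorm 2 u ^ 2 *
        ∑ i, if u j = 0 ∧ u i ≠ 0 then x (i, j) ^ 2 + x (j, i) ^ 2 else 0 := by
    by_cases hj : u j = 0
    · have hrestrict : ∑ i, u i * symm (toMat x) i j =
          ∑ i, u i * if u i ≠ 0 then symm (toMat x) i j else 0 :=
        Finset.sum_congr rfl fun i _ => by by_cases hi : u i = 0 <;> simp [hi]
      rw [Set.indicator_of_mem (by exact hj), Matrix.vecMul, dotProduct, hrestrict]
      refine (Finset.sum_mul_sq_le_sq_mul_sq _ _ _).trans ?_
      rw [ellpNorm_two_sq]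
      gcongr with i
      by_cases hi : u i = 0 <;> simp [hi, hj, hsymm]
    · simp [hj]
  calc ∑ j, {j | u j = 0}.indicator (u ᵥ* symm (toMat x)) j ^ 2
      ≤ ellpNorm 2 u ^ 2 *
          ∑ j, ∑ i, if u j = 0 ∧ u i ≠ 0 then x (i, j) ^ 2 + x (j, i) ^ 2 else 0 := by
        rw [Finset.mul_sum]
        exact Finset.sum_le_sum fun j _ => hcs j
    _ = ellpNorm 2 u ^ 2 * ∑ i, ∑ j, ((if u j = 0 ∧ u i ≠ 0 then x (i, j) ^ 2 else 0) +
          if u i = 0 ∧ u j ≠ 0 then x (i, j) ^ 2 else 0) := by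
        simp only [ite_add_zero, Finset.sum_add_distrib]
        rw [Finset.sum_comm (f := fun i j => if u j = 0 ∧ u i ≠ 0 then x (i, j) ^ 2 else 0)]
    _ ≤ ellpNorm 2 u ^ 2 * ‖x‖ ^ 2 := by
        rw [EuclideanSpace.real_norm_sq_eq, Fintype.sum_prod_type]
        gcongr with i _ j
        have := sq_nonneg (x (i, j))
        by_cases hi : u i = 0 <;> by_cases hj : u j = 0 <;> simp [hi, hj, this]

lemma measureReal_ellpNorm_indicator_vecMul_gt_le {q : ℝ} (hq : 2 ≤ q) (u : Fin n → ℝ) {r : ℝ}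
    (hr : 0 ≤ r) :
    (stdGaussian (MatSpace n)).real {x | ellpNorm 2 u * (xi q * (n : ℝ) ^ (1 / q) + 1 + r) <
        ellpNorm q ({j | u j = 0}.indicator (u ᵥ* symm (toMat x)))} ≤
      Real.exp (-(2 * r ^ 2 / Real.pi ^ 2)) := by
  classical
  have hq0 : 0 < q := by linarith
  rcases eq_or_ne u 0 with rfl | hu
  · have hnorm (q : ℝ) (hq0 : 0 < q) : ellpNorm q (0 : Fin n → ℝ) = 0 := by
      simpa using ellpNorm_smul hq0 0 (0 : Fin n → ℝ)
    simp [hnorm, hq0, (Real.exp_pos _).le]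
  set s := ellpNorm 2 u
  have hs : 0 < s := by
    obtain ⟨i, hi⟩ := Function.ne_iff.1 hu
    exact (abs_pos.2 hi).trans_le (abs_le_ellpNorm two_pos u i)
  let L : Fin n → StrongDual ℝ (MatSpace n) := fun j =>
    if u j = 0 then ∑ i, (s⁻¹ * u i * (1 / √2)) •
      (EuclideanSpace.proj (i, j) + EuclideanSpace.proj (j, i) : StrongDual ℝ (MatSpace n)) else 0
  have hL (x : MatSpace n) :
      (fun j => L j x) = s⁻¹ • {j | u j = 0}.indicator (u ᵥ* symm (toMat x)) := by
    ext j
    by_cases hj : u j = 0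
    · simp only [L, hj, if_true, Pi.smul_apply, smul_eq_mul, Matrix.vecMul, dotProduct,
        Set.indicator_of_mem (show j ∈ {j | u j = 0} from hj), Finset.mul_sum, symm_toMat_apply]
      simp [mul_assoc, mul_add]
    · simp [L, hj]
  have hsq (x : MatSpace n) : ∑ j, L j x ^ 2 ≤ ‖x‖ ^ 2 := by
    rw [← ellpNorm_two_sq, hL, ellpNorm_smul two_pos, mul_pow, sq_abs, inv_pow,
      inv_mul_le_iff₀ (by positivity), ellpNorm_two_sq ({j | u j = 0}.indicator _)]
    exact sum_sq_indicator_vecMul_symm_le u x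
  refine (measureReal_mono (fun x hx => ?_) (measure_ne_top _ _)).trans
    (measureReal_ellpNorm_ge_le hq L hsq hr)
  simp only [Set.mem_ofPred_eq, hL, ellpNorm_smul hq0, abs_inv, abs_of_pos hs] at hx ⊢
  exact (le_inv_mul_iff₀ hs).2 hx.le

lemma measureReal_column_gt_le (hn : 2 ≤ n) {q d K : ℝ} (hq : 2 ≤ q) (hd : 0 ≤ d)
    (hK2 : 2 ≤ K) (hK : d + 3 ≤ 2 * (K - 2) ^ 2 / Real.pi ^ 2) (m : Fin n → ℤ) :
    (stdGaussian (MatSpace n)).real {x | ellpNorm 2 (fun i => (m i : ℝ)) *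
        (xi q * (n : ℝ) ^ (1 / q) + K * √(hammingNorm m) * √(Real.log n)) <
          ellpNorm q ({j | m j = 0}.indicator ((fun i => (m i : ℝ)) ᵥ* symm (toMat x)))} ≤
      (n : ℝ) ^ (-d) * ((n : ℝ)⁻¹ ^ 3) ^ hammingNorm m := by
  rcases eq_or_ne m 0 with rfl | hm
  · refine Eq.trans_le (b := (0 : ℝ)) ?_ (by positivity)
    simp [← Pi.zero_def, ellpNorm, Real.zero_rpow (show q ≠ 0 by linarith),
      Real.zero_rpow (inv_ne_zero (show q ≠ 0 by linarith))]
  set a : ℝ := (hammingNorm m : ℝ) with ha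
  have ha1 : 1 ≤ a := Nat.one_le_cast.2 (hammingNorm_pos_iff.2 hm)
  have hlog0 : 0 ≤ Real.log n := Real.log_natCast_nonneg n
  have hlog : 1 / 2 ≤ √(Real.log n) := by
    have := Real.log_two_gt_d9
    have : Real.log 2 ≤ Real.log n := Real.log_le_log two_pos (by exact_mod_cast hn)
    exact Real.le_sqrt_of_sq_le (by linarith)
  have hone : 1 ≤ 2 * √a * √(Real.log n) := by nlinarith [Real.one_le_sqrt.2 ha1]
  set r := (K - 2) * √a * √(Real.log n) with hr
  have hr0 : 0 ≤ r := mul_nonneg (mul_nonneg (by linarith) (by positivity)) (by positivity)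
  have hexp : (d + 3 * a) * Real.log n ≤ 2 * r ^ 2 / Real.pi ^ 2 := by
    rw [hr, mul_pow, mul_pow, Real.sq_sqrt hlog0, Real.sq_sqrt (by positivity)]
    calc (d + 3 * a) * Real.log n ≤ (d + 3) * a * Real.log n := by gcongr; nlinarith
      _ ≤ 2 * (K - 2) ^ 2 / Real.pi ^ 2 * a * Real.log n := by gcongr
      _ = 2 * ((K - 2) ^ 2 * a * Real.log n) / Real.pi ^ 2 := by ring
  refine (measureReal_mono (fun x hx => ?_) (measure_ne_top _ _)).trans
    ((measureReal_ellpNorm_indicator_vecMul_gt_le hq (fun i => (m i : ℝ)) hr0).trans ?_)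
  · simp only [Set.mem_ofPred_eq, Int.cast_eq_zero]
    refine lt_of_le_of_lt (mul_le_mul_of_nonneg_left ?_ (ellpNorm_nonneg _ _)) hx
    linarith
  · rw [← pow_mul, ← exp_neg_add_mul_log (by omega), Nat.cast_mul, Nat.cast_ofNat, ← ha]
    gcongr

lemma measureReal_not_columnBound_le (hn : 2 ≤ n) {q d K : ℝ} (hq : 2 ≤ q) (hd : 0 ≤ d)
    (hK2 : 2 ≤ K) (hK : d + 3 ≤ 2 * (K - 2) ^ 2 / Real.pi ^ 2) :
    (stdGaussian (MatSpace n)).real {x | ¬ ColumnBound q K (toMat x)} ≤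
      Real.exp 2 * (n : ℝ) ^ (-d) := by
  set s : Finset ℤ := Finset.Icc (-n ^ 2) (n ^ 2) with hs
  have hcard : (s.card - 1 : ℝ) = 2 * n ^ 2 := by
    have : (s.card : ℤ) = 2 * n ^ 2 + 1 := by
      rw [hs, Int.card_Icc_of_le _ _ (by nlinarith)]
      ring
    rw [sub_eq_iff_eq_add]
    exact_mod_cast this
  have hsum : ∑ m ∈ Fintype.piFinset (fun _ : Fin n => s), ((n : ℝ)⁻¹ ^ 3) ^ hammingNorm m ≤
      Real.exp 2 := by
    rw [sum_pow_hammingNorm (by simp [hs]), hcard, Fintype.card_fin]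
    refine le_trans (le_of_eq ?_) (one_add_div_pow_le_exp (n := n) zero_le_two)
    field_simp
  calc (stdGaussian (MatSpace n)).real {x | ¬ ColumnBound q K (toMat x)}
      ≤ (stdGaussian (MatSpace n)).real (⋃ m ∈ Fintype.piFinset (fun _ : Fin n => s),
          {x | ellpNorm 2 (fun i => (m i : ℝ)) *
            (xi q * (n : ℝ) ^ (1 / q) + K * √(hammingNorm m) * √(Real.log n)) <
          ellpNorm q ({j | m j = 0}.indicator ((fun i => (m i : ℝ)) ᵥ* symm (toMat x)))}) := by
        refine measureReal_mono (fun x hx => ?_) (measure_ne_top _ _)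
        simpa [ColumnBound, hs, abs_le] using hx
    _ ≤ ∑ m ∈ Fintype.piFinset (fun _ : Fin n => s),
          (n : ℝ) ^ (-d) * ((n : ℝ)⁻¹ ^ 3) ^ hammingNorm m :=
        (measureReal_biUnion_finset_le _ _).trans
          (Finset.sum_le_sum fun m _ => measureReal_column_gt_le hn hq hd hK2 hK m)
    _ ≤ Real.exp 2 * (n : ℝ) ^ (-d) := by
        rw [← Finset.mul_sum, mul_comm]
        gcongr

lemma hasLaw_toLp_stdGaussian {Ω : Type*} [MeasurableSpace Ω] {P : Measure Ω}
    {G : Ω → Matrix (Fin n) (Fin n) ℝ} (hG : IsStdGaussianMatrix P G) :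
    HasLaw (fun ω => (WithLp.toLp 2 fun ij => G ω ij.1 ij.2 : MatSpace n))
      (stdGaussian (MatSpace n)) P := by
  have : IsProbabilityMeasure P := hG.2.isProbabilityMeasure
  have hm (ij : Fin n × Fin n) : AEMeasurable (fun ω => G ω ij.1 ij.2) P :=
    (hG.1 ij.1 ij.2).aemeasurable
  have hpi := hG.2.map_fun_eq_pi_map hm
  simp_rw [(hG.1 _ _).map_eq] at hpi
  have hlp : Measurable (WithLp.toLp 2 : (Fin n × Fin n → ℝ) → MatSpace n) := by fun_prop
  have hm' := aemeasurable_pi_iff.2 hm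
  refine ⟨hlp.comp_aemeasurable hm', ?_⟩
  rw [← map_pi_eq_stdGaussian, ← hpi, AEMeasurable.map_map_of_aemeasurable hlp.aemeasurable hm']
  rfl

theorem exists_measureReal_not_typical_le {q d : ℝ} (hq : 2 ≤ q) (hd : 0 ≤ d) :
    ∃ K C : ℝ, 0 < K ∧ 0 < C ∧ ∀ n : ℕ, 2 ≤ n →
      ∀ (Ω : Type*) [MeasurableSpace Ω] (P : Measure Ω) [IsProbabilityMeasure P]
        (G : Ω → Matrix (Fin n) (Fin n) ℝ), IsStdGaussianMatrix P G →
        P.real {ω | ¬ (SignBound K (G ω) ∧ ColumnBound q K (G ω))} ≤ C * (n : ℝ) ^ (-d) := by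
  have hpi := Real.pi_gt_three
  set K : ℝ := 2 + (d + 3) * Real.pi with hK
  refine ⟨K, Real.exp 4 + Real.exp 2, by positivity, by positivity, ?_⟩
  intro n hn Ω _ P _ G hG
  have hK1 : d + 1 ≤ K ^ 2 / 2 := by
    have : d + 4 ≤ K := by nlinarith
    nlinarith
  have hK2 : d + 3 ≤ 2 * (K - 2) ^ 2 / Real.pi ^ 2 := by
    rw [hK, add_sub_cancel_left, mul_pow, ← mul_assoc, mul_div_cancel_right₀ _ (by positivity)]
    nlinarith
  have hlaw := hasLaw_toLp_stdGaussian hG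
  calc P.real {ω | ¬ (SignBound K (G ω) ∧ ColumnBound q K (G ω))}
      ≤ (stdGaussian (MatSpace n)).real
        ({x | ¬ SignBound K (toMat x)} ∪ {x | ¬ ColumnBound q K (toMat x)}) := by
        rw [← hlaw.map_eq]
        refine ENNReal.toReal_mono (measure_ne_top _ _)
          (le_trans (measure_mono fun ω hω => ?_) (Measure.le_map_apply hlaw.aemeasurable _))
        exact not_and_or.1 hω
    _ ≤ Real.exp 4 * (n : ℝ) ^ (-d) + Real.exp 2 * (n : ℝ) ^ (-d) :=
        (measureReal_union_le _ _).trans (add_le_add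
          (measureReal_not_signBound_le (by omega) hd (by positivity) hK1)
          (measureReal_not_columnBound_le hn hq hd (by rw [hK]; nlinarith) hK2))
    _ = (Real.exp 4 + Real.exp 2) * (n : ℝ) ^ (-d) := by ring

end TypicalMatrices

section LayerCake

variable {n : ℕ} {p T : ℝ} {x : Fin n → ℝ}

/-- The signs of the coordinates of `x` of absolute value at least `t`, and `0` elsewhere. Averaging
over the level `t` recovers `x`. -/
noncomputable def signAbove (t : ℝ) (x : Fin n → ℝ) : Fin n → SignType :=
  fun i => if t ≤ |x i| then SignType.sign (x i) else 0

lemma antitone_hammingNorm_signAbove (x : Fin n → ℝ) :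
    Antitone fun t => (hammingNorm (signAbove t x) : ℝ) := by
  intro s t hst
  simp only [hammingNorm, signAbove, ne_eq, ite_eq_right_iff, Classical.not_imp]
  gcongr

lemma hammingNorm_signAbove_le (hp : 0 < p) {t : ℝ} (ht : 0 < t) (x : Fin n → ℝ) :
    hammingNorm (signAbove t x) ≤ t ^ (-p) * ∑ i, |x i| ^ p := by
  rw [Real.rpow_neg ht.le, ← div_eq_inv_mul, le_div_iff₀ (by positivity), hammingNorm,
    ← nsmul_eq_mul, ← Finset.sum_const]
  calc ∑ i with signAbove t x i ≠ 0, t ^ p ≤ ∑ i with signAbove t x i ≠ 0, |x i| ^ p := by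
        refine Finset.sum_le_sum fun i hi => ?_
        have : t ≤ |x i| := by
          by_contra h
          simp [signAbove, h] at hi
        gcongr
    _ ≤ ∑ i, |x i| ^ p :=
        Finset.sum_le_univ_sum_of_nonneg fun _ => by positivity

lemma signAbove_apply_eq_indicator (t : ℝ) (x : Fin n → ℝ) (i : Fin n) :
    (signAbove t x i : ℝ) = {s | s ≤ |x i|}.indicator (fun _ => (SignType.sign (x i) : ℝ)) t := by
  by_cases h : t ≤ |x i| <;> simp [signAbove, h]

lemma intervalIntegrable_signAbove (x : Fin n → ℝ) (i : Fin n) :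
    IntervalIntegrable (fun t => (signAbove t x i : ℝ)) volume 0 T := by
  simp only [signAbove_apply_eq_indicator]
  rw [intervalIntegrable_iff]
  exact (integrableOn_const (by simp)).indicator measurableSet_Iic

lemma integral_signAbove (hx : ∀ i, |x i| ≤ T) (i : Fin n) :
    ∫ t in 0..T, (signAbove t x i : ℝ) = x i := by
  simp only [signAbove_apply_eq_indicator]
  rw [intervalIntegral.integral_indicator ⟨abs_nonneg _, hx i⟩, intervalIntegral.integral_const,
    sub_zero, smul_eq_mul, abs_mul_sign]

lemma intervalIntegrable_signAbove_dotProduct (x c : Fin n → ℝ) :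
    IntervalIntegrable (fun t => (fun i => (signAbove t x i : ℝ)) ⬝ᵥ c) volume 0 T := by
  simpa only [dotProduct, Finset.sum_fn] using
    IntervalIntegrable.sum Finset.univ fun i _ =>
      (intervalIntegrable_signAbove (T := T) x i).mul_const (c i)

lemma integral_signAbove_dotProduct (hx : ∀ i, |x i| ≤ T) (c : Fin n → ℝ) :
    ∫ t in 0..T, (fun i => (signAbove t x i : ℝ)) ⬝ᵥ c = x ⬝ᵥ c := by
  simp only [dotProduct]
  rw [intervalIntegral.integral_finsetSum fun i _ =>
    (intervalIntegrable_signAbove x i).mul_const (c i)]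
  simp only [intervalIntegral.integral_mul_const, integral_signAbove hx]

lemma hammingNorm_signAbove_eq_dotProduct (t : ℝ) (x : Fin n → ℝ) :
    (hammingNorm (signAbove t x) : ℝ) =
      (fun i => (signAbove t x i : ℝ)) ⬝ᵥ fun i => (SignType.sign (x i) : ℝ) := by
  rw [hammingNorm, Finset.card_filter, Nat.cast_sum, dotProduct]
  refine Finset.sum_congr rfl fun i _ => ?_
  rcases lt_trichotomy (x i) 0 with h | h | h <;> by_cases ht : t ≤ |x i| <;>
    simp [signAbove, h, ht]

lemma integral_hammingNorm_signAbove (hx : ∀ i, |x i| ≤ T) :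
    ∫ t in 0..T, (hammingNorm (signAbove t x) : ℝ) = ∑ i, |x i| := by
  simp only [hammingNorm_signAbove_eq_dotProduct]
  rw [integral_signAbove_dotProduct hx]
  exact Finset.sum_congr rfl fun i _ => self_mul_sign (x i)

lemma intervalIntegrable_sqrt_hammingNorm_signAbove (x : Fin n → ℝ) :
    IntervalIntegrable (fun t => √(hammingNorm (signAbove t x))) volume 0 T :=
  (Real.sqrt_monotone.comp_antitone (antitone_hammingNorm_signAbove x)).intervalIntegrable

lemma dotProduct_le_of_signAbove_le (hT : 0 ≤ T) (hx : ∀ i, |x i| ≤ T) {c : Fin n → ℝ} {A B : ℝ}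
    (h : ∀ t, (fun i => (signAbove t x i : ℝ)) ⬝ᵥ c ≤
      A * hammingNorm (signAbove t x) + B * √(hammingNorm (signAbove t x))) :
    x ⬝ᵥ c ≤ A * ∑ i, |x i| + B * ∫ t in 0..T, √(hammingNorm (signAbove t x)) := by
  have hN : IntervalIntegrable (fun t => (hammingNorm (signAbove t x) : ℝ)) volume 0 T :=
    (antitone_hammingNorm_signAbove x).intervalIntegrable
  have hsqrt := intervalIntegrable_sqrt_hammingNorm_signAbove (T := T) x
  rw [← integral_signAbove_dotProduct hx c, ← integral_hammingNorm_signAbove hx,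
    ← intervalIntegral.integral_const_mul, ← intervalIntegral.integral_const_mul,
    ← intervalIntegral.integral_add (hN.const_mul A) (hsqrt.const_mul B)]
  exact intervalIntegral.integral_mono hT (intervalIntegrable_signAbove_dotProduct x c)
    ((hN.const_mul A).add (hsqrt.const_mul B)) h

lemma integral_sqrt_hammingNorm_signAbove_le (hp0 : 0 < p) (hp2 : p < 2) (hT : 0 ≤ T)
    (hx : ∑ i, |x i| ^ p ≤ 1) :
    ∫ t in 0..T, √(hammingNorm (signAbove t x)) ≤ 2 / (2 - p) * T ^ (1 - p / 2) := by
  have hexp : -1 < -p / 2 := by linarith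
  calc ∫ t in 0..T, √(hammingNorm (signAbove t x)) ≤ ∫ t in 0..T, t ^ (-p / 2) := by
        refine intervalIntegral.integral_mono_on_of_le_Ioo hT
          (intervalIntegrable_sqrt_hammingNorm_signAbove x)
          (intervalIntegral.intervalIntegrable_rpow' hexp) fun t ht => ?_
        rw [Real.sqrt_le_iff, ← Real.rpow_natCast, ← Real.rpow_mul ht.1.le, Nat.cast_ofNat,
          div_mul_cancel₀ _ two_ne_zero]
        have htp := Real.rpow_nonneg ht.1.le
        exact ⟨htp _, (hammingNorm_signAbove_le hp0 ht.1 x).trans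
          (mul_le_of_le_one_right (htp _) hx)⟩
    _ = 2 / (2 - p) * T ^ (1 - p / 2) := by
        rw [integral_rpow (Or.inl hexp), Real.zero_rpow (by linarith), sub_zero,
          show -p / 2 + 1 = 1 - p / 2 by ring]
        have : 2 - p ≠ 0 := by linarith
        field_simp

lemma SignBound.dotProduct_mulVec_self_le {K : ℝ} {G : Matrix (Fin n) (Fin n) ℝ}
    (hG : SignBound K G) (hT : 0 ≤ T) (hx : ∀ i, |x i| ≤ T) :
    x ⬝ᵥ G *ᵥ x ≤ 2 * (K * √(Real.log n)) * (∑ i, |x i|) *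
      ∫ t in 0..T, √(hammingNorm (signAbove t x)) := by
  set κ := K * √(Real.log n)
  set I := ∫ t in 0..T, √(hammingNorm (signAbove t x))
  have hrow (s : ℝ) : (fun i => (signAbove s x i : ℝ)) ⬝ᵥ G *ᵥ x ≤
      κ * I * hammingNorm (signAbove s x) + κ * (∑ i, |x i|) * √(hammingNorm (signAbove s x)) := by
    rw [Matrix.dotProduct_mulVec, dotProduct_comm]
    refine (dotProduct_le_of_signAbove_le hT hx (A := κ * √(hammingNorm (signAbove s x)))
      (B := κ * hammingNorm (signAbove s x)) fun t => ?_).trans_eq (by ring)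
    rw [dotProduct_comm, ← Matrix.dotProduct_mulVec]
    exact (hG _ _).trans_eq (by ring)
  exact (dotProduct_le_of_signAbove_le hT hx hrow).trans_eq (by ring)

end LayerCake

section HeavyLight

variable {n : ℕ} {p t K : ℝ} {x : Fin n → ℝ}

/-- The order `n^(p/(2p*)) √(log n)` of the error term, using `p/p* = p - 1`. -/
noncomputable def errorScale (p : ℝ) (n : ℕ) : ℝ := (n : ℝ) ^ ((p - 1) / 2) * √(Real.log n)

lemma errorScale_nonneg (p : ℝ) (n : ℕ) : 0 ≤ errorScale p n := by
  unfold errorScale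
  positivity

/-- The threshold `n^(-1/p*)` separating the heavy coordinates of an `ℓ_p`-unit vector, few enough
for a union bound over their rounded values, from the light ones. -/
noncomputable def heavyThreshold (p : ℝ) (n : ℕ) : ℝ := (n : ℝ) ^ (1 / p - 1)

/-- The coordinates at which `x` exceeds `heavyThreshold`. -/
def heavySet (p : ℝ) (x : Fin n → ℝ) : Set (Fin n) := {i | heavyThreshold p n < |x i|}

lemma abs_indicator_le_abs (S : Set (Fin n)) (x : Fin n → ℝ) (i : Fin n) :
    |S.indicator x i| ≤ |x i| :=
  norm_indicator_le_norm_self x i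

lemma sum_abs_indicator_rpow_le (hp : 0 ≤ p) (S : Set (Fin n)) (x : Fin n → ℝ) :
    ∑ i, |S.indicator x i| ^ p ≤ ∑ i, |x i| ^ p := by
  gcongr ∑ i, ?_ ^ p with i
  exact abs_indicator_le_abs S x i

lemma dotProduct_mulVec_add_self (G : Matrix (Fin n) (Fin n) ℝ) (y z : Fin n → ℝ) :
    (y + z) ⬝ᵥ G *ᵥ (y + z) = y ⬝ᵥ G *ᵥ y + z ⬝ᵥ G *ᵥ z + √2 * (y ⬝ᵥ symm G *ᵥ z) := by
  have hsymm : √2 * (y ⬝ᵥ symm G *ᵥ z) = y ⬝ᵥ G *ᵥ z + z ⬝ᵥ G *ᵥ y := by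
    rw [symm, Matrix.smul_mulVec, dotProduct_smul, smul_eq_mul, ← mul_assoc,
      mul_one_div_cancel (by positivity), one_mul, Matrix.add_mulVec, dotProduct_add,
      Matrix.mulVec_transpose, dotProduct_comm y (z ᵥ* G), ← Matrix.dotProduct_mulVec]
  rw [hsymm, Matrix.mulVec_add, dotProduct_add, add_dotProduct, add_dotProduct]
  ring

lemma SignBound.dotProduct_mulVec_self_le_of_abs_le {G : Matrix (Fin n) (Fin n) ℝ}
    (hG : SignBound K G) (hK : 0 ≤ K) (hp0 : 0 < p) (hp2 : p < 2) (ht : 0 ≤ t)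
    (hxt : ∀ i, |x i| ≤ t) (hx : ∑ i, |x i| ^ p ≤ 1) :
    x ⬝ᵥ G *ᵥ x ≤ 4 / (2 - p) * (K * √(Real.log n)) * ((∑ i, |x i|) * t ^ (1 - p / 2)) := by
  calc x ⬝ᵥ G *ᵥ x ≤ 2 * (K * √(Real.log n)) * (∑ i, |x i|) *
        ∫ s in 0..t, √(hammingNorm (signAbove s x)) := hG.dotProduct_mulVec_self_le ht hxt
    _ ≤ 2 * (K * √(Real.log n)) * (∑ i, |x i|) * (2 / (2 - p) * t ^ (1 - p / 2)) := by
        gcongr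
        exact integral_sqrt_hammingNorm_signAbove_le hp0 hp2 ht hx
    _ = _ := by ring

lemma hammingNorm_indicator_heavySet_le (hp : 0 < p) (hn : 0 < n) (hx : ∑ i, |x i| ^ p ≤ 1) :
    (hammingNorm ((heavySet p x).indicator x) : ℝ) ≤ (n : ℝ) ^ (p - 1) := by
  have hn0 : (0 : ℝ) < n := by positivity
  have ht : 0 < heavyThreshold p n := by unfold heavyThreshold; positivity
  calc (hammingNorm ((heavySet p x).indicator x) : ℝ)
      ≤ hammingNorm (signAbove (heavyThreshold p n) x) := by
        simp only [hammingNorm, Nat.cast_le]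
        gcongr with i
        intro hi
        by_cases hiS : i ∈ heavySet p x
        · simpa [hiS, signAbove, hiS.out.le] using hi
        · simp [hiS]
    _ ≤ heavyThreshold p n ^ (-p) * 1 := by
        grw [hammingNorm_signAbove_le hp ht x, hx]
    _ = (n : ℝ) ^ (p - 1) := by
        rw [mul_one, heavyThreshold, ← Real.rpow_mul hn0.le]
        congr 1
        field

lemma sum_abs_indicator_heavySet_le (hp1 : 1 ≤ p) (hp2 : p ≤ 2) (hn : 0 < n)
    (hx : ∑ i, |x i| ^ p ≤ 1) :
    ∑ i, |(heavySet p x).indicator x i| ≤ (n : ℝ) ^ ((p - 1) / 2) := by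
  have hn1 : (1 : ℝ) ≤ n := by exact_mod_cast hn
  have ht : 0 < heavyThreshold p n := by unfold heavyThreshold; positivity
  have hterm (i : Fin n) : |(heavySet p x).indicator x i| ≤
      heavyThreshold p n ^ (1 - p) * |x i| ^ p := by
    by_cases hi : i ∈ heavySet p x
    · rw [Set.indicator_of_mem hi]
      calc |x i| = |x i| ^ (1 - p) * |x i| ^ p := by
            rw [← Real.rpow_add (ht.trans hi), sub_add_cancel, Real.rpow_one]
        _ ≤ heavyThreshold p n ^ (1 - p) * |x i| ^ p := by
            gcongr ?_ * _
            exact Real.rpow_le_rpow_of_nonpos ht (le_of_lt hi) (by linarith)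
    · rw [Set.indicator_of_notMem hi, abs_zero]
      positivity
  calc ∑ i, |(heavySet p x).indicator x i|
      ≤ heavyThreshold p n ^ (1 - p) * 1 := by
        grw [Finset.sum_le_sum fun i _ => hterm i, ← Finset.mul_sum, hx]
    _ = (n : ℝ) ^ ((p - 1) ^ 2 / p) := by
        rw [mul_one, heavyThreshold, ← Real.rpow_mul (by positivity)]
        congr 1
        field
    _ ≤ (n : ℝ) ^ ((p - 1) / 2) := by
        refine Real.rpow_le_rpow_of_exponent_le hn1 ?_
        rw [div_le_div_iff₀ (by positivity) two_pos]
        nlinarith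

lemma sum_abs_mul_heavyThreshold_rpow_le (hp1 : 1 ≤ p) (hn : 0 < n) (hx : ∑ i, |x i| ^ p ≤ 1) :
    (∑ i, |x i|) * heavyThreshold p n ^ (1 - p / 2) ≤ (n : ℝ) ^ ((p - 1) / 2) := by
  have hn0 : (0 : ℝ) < n := by positivity
  have hsum : ∑ i, |x i| ≤ (n : ℝ) ^ (1 - 1 / p) := by
    have hpow : (∑ i, |x i|) ^ p ≤ ((n : ℝ) ^ (1 - 1 / p)) ^ p := by
      calc (∑ i, |x i|) ^ p ≤ (n : ℝ) ^ (p - 1) * ∑ i, |x i| ^ p := by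
            simpa using Real.rpow_sum_le_const_mul_sum_rpow Finset.univ x hp1
        _ ≤ (n : ℝ) ^ (p - 1) * 1 := by gcongr
        _ = ((n : ℝ) ^ (1 - 1 / p)) ^ p := by
            rw [mul_one, ← Real.rpow_mul hn0.le]
            congr 1
            field
    exact (Real.rpow_le_rpow_iff (by positivity) (by positivity) (by positivity)).1 hpow
  calc (∑ i, |x i|) * heavyThreshold p n ^ (1 - p / 2)
      ≤ (n : ℝ) ^ (1 - 1 / p) * heavyThreshold p n ^ (1 - p / 2) := by
        gcongr
        exact Real.rpow_nonneg (Real.rpow_nonneg hn0.le _) _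
    _ = (n : ℝ) ^ ((p - 1) / 2) := by
        rw [heavyThreshold, ← Real.rpow_mul hn0.le, ← Real.rpow_add hn0]
        congr 1
        field

lemma SignBound.dotProduct_mulVec_self_le_cross_term {G : Matrix (Fin n) (Fin n) ℝ}
    (hG : SignBound K G) (hK : 0 ≤ K) (hp1 : 1 ≤ p) (hp2 : p < 2) (hn : 0 < n)
    (hx : ∑ i, |x i| ^ p ≤ 1) :
    x ⬝ᵥ G *ᵥ x ≤ 8 / (2 - p) * K * errorScale p n +
      √2 * ((heavySet p x).indicator x ⬝ᵥ symm G *ᵥ (heavySet p x)ᶜ.indicator x) := by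
  have hp0 : 0 < p := by linarith
  have h2p : 0 < 2 - p := by linarith
  set S := heavySet p x
  have hsum (A : Set (Fin n)) : ∑ i, |A.indicator x i| ^ p ≤ 1 :=
    (sum_abs_indicator_rpow_le hp0.le A x).trans hx
  have hheavy : S.indicator x ⬝ᵥ G *ᵥ S.indicator x ≤
      4 / (2 - p) * (K * √(Real.log n)) * (n : ℝ) ^ ((p - 1) / 2) := by
    have hle_one (i : Fin n) : |S.indicator x i| ≤ 1 :=
      (abs_le_ellpNorm hp0 _ i).trans
        (ellpNorm_le_of_sum_le hp0 zero_le_one (by simpa using hsum S))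
    grw [hG.dotProduct_mulVec_self_le_of_abs_le hK hp0 hp2 zero_le_one hle_one (hsum S),
      Real.one_rpow, mul_one, sum_abs_indicator_heavySet_le hp1 hp2.le hn hx]
  have hlight : Sᶜ.indicator x ⬝ᵥ G *ᵥ Sᶜ.indicator x ≤
      4 / (2 - p) * (K * √(Real.log n)) * (n : ℝ) ^ ((p - 1) / 2) := by
    have ht : 0 ≤ heavyThreshold p n := Real.rpow_nonneg n.cast_nonneg _
    have hle (i : Fin n) : |Sᶜ.indicator x i| ≤ heavyThreshold p n := by
      by_cases hi : i ∈ S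
      · simpa [hi] using ht
      · simpa [hi] using not_lt.1 hi
    grw [hG.dotProduct_mulVec_self_le_of_abs_le hK hp0 hp2 ht hle (hsum Sᶜ),
      sum_abs_mul_heavyThreshold_rpow_le hp1 hn (hsum Sᶜ)]
  conv_lhs => rw [← Set.indicator_self_add_compl S x]
  rw [dotProduct_mulVec_add_self, errorScale]
  grw [hheavy, hlight]
  exact le_of_eq (by ring)

end HeavyLight

section ColumnEstimate

variable {n : ℕ} {p q K : ℝ} {G : Matrix (Fin n) (Fin n) ℝ}

lemma hammingNorm_single {ι α : Type*} [Fintype ι] [DecidableEq ι] [Zero α] [DecidableEq α] (i : ι)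
    {a : α} (ha : a ≠ 0) : hammingNorm (Pi.single i a : ι → α) = 1 := by
  have hsupp : ({j | (Pi.single i a : ι → α) j ≠ 0} : Finset ι) = {i} := by
    ext j
    by_cases hj : j = i <;> simp [hj, ha]
  rw [hammingNorm, hsupp, Finset.card_singleton]

lemma SignBound.abs_apply_le (hG : SignBound K G) (i j : Fin n) :
    |G i j| ≤ 2 * (K * √(Real.log n)) := by
  have hcast (k : Fin n) (s : SignType) :
      (fun l => ((Pi.single k s : Fin n → SignType) l : ℝ)) = Pi.single k (s : ℝ) := by
    ext l
    by_cases hl : l = k <;> simp [hl]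
  have hbound {s : SignType} (hs : s ≠ 0) : (s : ℝ) * G i j ≤ 2 * (K * √(Real.log n)) := by
    have h := hG (Pi.single i s) (Pi.single j 1)
    rw [hammingNorm_single i hs, hammingNorm_single j one_ne_zero, hcast, hcast,
      single_dotProduct] at h
    simp only [SignType.coe_one, Matrix.mulVec_single_one, Matrix.col_apply, Nat.cast_one,
      Real.sqrt_one, mul_one] at h
    linarith
  have hpos := hbound (s := 1) one_ne_zero
  have hneg := hbound (s := -1) (by decide)
  rw [abs_le]
  simp only [SignType.coe_one, SignType.coe_neg_one, neg_one_mul, one_mul] at hpos hneg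
  constructor <;> linarith

lemma SignBound.abs_symm_apply_le (hG : SignBound K G) (i j : Fin n) :
    |symm G i j| ≤ 4 * (K * √(Real.log n)) := by
  rw [symm, Matrix.smul_apply, Matrix.add_apply, Matrix.transpose_apply, smul_eq_mul, abs_mul,
    abs_of_nonneg (by positivity)]
  calc 1 / √2 * |G i j + G j i| ≤ 1 * |G i j + G j i| := by
        gcongr
        exact div_le_one_of_le₀ (Real.one_le_sqrt.2 one_le_two) (by positivity)
    _ ≤ 1 * (|G i j| + |G j i|) := by grw [abs_add_le]
    _ ≤ 1 * (2 * (K * √(Real.log n)) + 2 * (K * √(Real.log n))) := by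
        grw [hG.abs_apply_le i j, hG.abs_apply_le j i]
    _ = _ := by ring

lemma SignBound.dotProduct_symm_mulVec_le_of_abs_le_one (hG : SignBound K G) (hp : 0 < p)
    {r : Fin n → ℝ} (hr : ∀ i, |r i| ≤ 1) (z : Fin n → ℝ) :
    r ⬝ᵥ symm G *ᵥ z ≤ n ^ 2 * (4 * (K * √(Real.log n)) * ellpNorm p z) := by
  simp only [dotProduct, Matrix.mulVec, Finset.mul_sum]
  calc ∑ i, ∑ j, r i * (symm G i j * z j)
      ≤ ∑ _i : Fin n, ∑ _j : Fin n, 1 * (4 * (K * √(Real.log n)) * ellpNorm p z) := by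
        refine Finset.sum_le_sum fun i _ => Finset.sum_le_sum fun j _ => (le_abs_self _).trans ?_
        have hK : 0 ≤ 4 * (K * √(Real.log n)) := (abs_nonneg _).trans (hG.abs_symm_apply_le i j)
        rw [abs_mul, abs_mul]
        exact mul_le_mul (hr i) (mul_le_mul (hG.abs_symm_apply_le i j) (abs_le_ellpNorm hp z j)
          (abs_nonneg _) hK) (by positivity) zero_le_one
    _ = n ^ 2 * (4 * (K * √(Real.log n)) * ellpNorm p z) := by
        simp only [Finset.sum_const, Finset.card_univ, Fintype.card_fin, nsmul_eq_mul]
        ring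

lemma ColumnBound.int_dotProduct_symm_mulVec_le (hG : ColumnBound q K G)
    (hpq : p.HolderConjugate q) {m : Fin n → ℤ} (hm : ∀ i, |m i| ≤ n ^ 2) {z : Fin n → ℝ}
    (hmz : ∀ i, m i = 0 ∨ z i = 0) :
    (fun i => (m i : ℝ)) ⬝ᵥ symm G *ᵥ z ≤ ellpNorm 2 (fun i => (m i : ℝ)) *
      (xi q * (n : ℝ) ^ (1 / q) + K * √(hammingNorm m) * √(Real.log n)) * ellpNorm p z := by
  have hrestrict : (fun i => (m i : ℝ)) ⬝ᵥ symm G *ᵥ z =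
      {j | m j = 0}.indicator ((fun i => (m i : ℝ)) ᵥ* symm G) ⬝ᵥ z := by
    rw [Matrix.dotProduct_mulVec]
    refine Finset.sum_congr rfl fun j _ => ?_
    rcases hmz j with hj | hj <;> simp [hj]
  have hz := ellpNorm_nonneg p z
  rw [hrestrict]
  grw [dotProduct_le_ellpNorm_mul hpq.symm, hG m hm]

lemma exists_int_abs_le_abs (t : ℝ) : ∃ m : ℤ, |(m : ℝ)| ≤ |t| ∧ |t - m| ≤ 1 := by
  rcases le_total 0 t with ht | ht
  · have hfloor : (0 : ℝ) ≤ ⌊t⌋ := by exact_mod_cast Int.floor_nonneg.2 ht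
    refine ⟨⌊t⌋, by rw [abs_of_nonneg hfloor, abs_of_nonneg ht]; exact Int.floor_le t, ?_⟩
    rw [abs_le]
    constructor <;> linarith [Int.floor_le t, Int.lt_floor_add_one t]
  · have hceil : (⌈t⌉ : ℝ) ≤ 0 := by exact_mod_cast Int.ceil_nonpos.2 ht
    refine ⟨⌈t⌉, by rw [abs_of_nonpos hceil, abs_of_nonpos ht]; linarith [Int.le_ceil t], ?_⟩
    rw [abs_le]
    constructor <;> linarith [Int.le_ceil t, Int.ceil_lt_add_one t]

lemma ColumnBound.dotProduct_symm_mulVec_le (hC : ColumnBound q K G) (hS : SignBound K G)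
    (hK : 0 ≤ K) (hpq : p.HolderConjugate q) (hn : 0 < n) {u z : Fin n → ℝ}
    (hu : ∀ i, |u i| ≤ 1) (huz : ∀ i, u i = 0 ∨ z i = 0) :
    u ⬝ᵥ symm G *ᵥ z ≤ ellpNorm p z * (ellpNorm 2 u * (xi q * (n : ℝ) ^ (1 / q) +
      K * √(hammingNorm u) * √(Real.log n)) + 4 * (K * √(Real.log n))) := by
  have hn2 : (0 : ℝ) < n ^ 2 := by positivity
  choose m hm_le hm_close using fun i => exists_int_abs_le_abs ((n : ℝ) ^ 2 * u i)
  simp only [abs_mul, abs_of_pos hn2] at hm_le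
  have hm_zero (i) (hi : u i = 0) : m i = 0 := by simpa [hi] using hm_le i
  have hm (i : Fin n) : |m i| ≤ n ^ 2 := by
    have : |(m i : ℝ)| ≤ n ^ 2 := (hm_le i).trans (mul_le_of_le_one_right hn2.le (hu i))
    exact_mod_cast this
  have hnorm : ellpNorm 2 (fun i => (m i : ℝ)) ≤ n ^ 2 * ellpNorm 2 u := by
    rw [← abs_of_pos hn2, ← ellpNorm_smul two_pos]
    exact ellpNorm_le_ellpNorm zero_le_two fun i => by
      simpa [abs_mul, abs_of_pos hn2] using hm_le i
  have hcard : hammingNorm m ≤ hammingNorm u := by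
    unfold hammingNorm
    gcongr with i
    exact hm_zero i
  have hmain := hC.int_dotProduct_symm_mulVec_le hpq hm fun i => (huz i).imp_left (hm_zero i)
  have hrest := hS.dotProduct_symm_mulVec_le_of_abs_le_one
    (r := (n : ℝ) ^ 2 • u - fun i => (m i : ℝ))
    hpq.pos hm_close z
  have hz := ellpNorm_nonneg p z
  have hu2 := ellpNorm_nonneg 2 u
  have hx : 0 ≤ xi q * (n : ℝ) ^ (1 / q) := mul_nonneg (xi_nonneg q) (by positivity)
  refine le_of_mul_le_mul_left ?_ hn2
  calc n ^ 2 * (u ⬝ᵥ symm G *ᵥ z)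
      = (fun i => (m i : ℝ)) ⬝ᵥ symm G *ᵥ z +
          ((n : ℝ) ^ 2 • u - fun i => (m i : ℝ)) ⬝ᵥ symm G *ᵥ z := by
        rw [sub_dotProduct, smul_dotProduct, smul_eq_mul, add_sub_cancel]
    _ ≤ n ^ 2 * ellpNorm 2 u *
          (xi q * (n : ℝ) ^ (1 / q) + K * √(hammingNorm u) * √(Real.log n)) * ellpNorm p z +
          n ^ 2 * (4 * (K * √(Real.log n)) * ellpNorm p z) := by
        grw [hmain, hrest, hnorm, hcard]
    _ = _ := by ring

lemma ColumnBound.ellpNorm_symm_row_le (hC : ColumnBound q K G) (hS : SignBound K G) (hq : 1 ≤ q)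
    (i : Fin n) :
    ellpNorm q (symm G i) ≤ xi q * (n : ℝ) ^ (1 / q) + 5 * (K * √(Real.log n)) := by
  have hn : 1 ≤ n := i.pos
  have hoff : ellpNorm q (({i}ᶜ : Set (Fin n)).indicator (symm G i)) ≤
      xi q * (n : ℝ) ^ (1 / q) + K * √(Real.log n) := by
    have hcast : (fun j => ((Pi.single i 1 : Fin n → ℤ) j : ℝ)) = basisVec i := by
      ext j
      by_cases hj : j = i <;> simp [basisVec, hj]
    have hle (j : Fin n) : |(Pi.single i 1 : Fin n → ℤ) j| ≤ n ^ 2 := by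
      have hn2 : (1 : ℤ) ≤ (n : ℤ) ^ 2 := one_le_pow₀ (by exact_mod_cast hn)
      by_cases hj : j = i
      · simpa [hj] using hn2
      · simp [hj]
    have hzero : {j | (Pi.single i 1 : Fin n → ℤ) j = 0} = {i}ᶜ := by
      ext j
      simp [Pi.single_apply]
    have hbound := hC _ hle
    rwa [hzero, hcast, hammingNorm_single i one_ne_zero, ellpNorm_basisVec two_pos, basisVec,
      Matrix.single_one_vecMul, Nat.cast_one, Real.sqrt_one, mul_one, one_mul] at hbound
  have hsplit : symm G i = ({i}ᶜ : Set (Fin n)).indicator (symm G i) + symm G i i • basisVec i := by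
    ext j
    by_cases hj : j = i <;> simp [basisVec, hj]
  calc ellpNorm q (symm G i)
      ≤ ellpNorm q (({i}ᶜ : Set (Fin n)).indicator (symm G i)) +
          ellpNorm q (symm G i i • basisVec i) := by
        conv_lhs => rw [hsplit]
        exact ellpNorm_add_le hq _ _
    _ ≤ (xi q * (n : ℝ) ^ (1 / q) + K * √(Real.log n)) + 4 * (K * √(Real.log n)) := by
        rw [ellpNorm_smul (by linarith), ellpNorm_basisVec (by linarith), mul_one]
        gcongr
        exact hS.abs_symm_apply_le i i
    _ = _ := by ring

end ColumnEstimate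

section HolderStability

variable {n : ℕ} {p q : ℝ}

lemma monotoneOn_rpow_sub_mul {r : ℝ} (hr0 : 0 < r) (hr1 : r ≤ 1) (M : ℝ) :
    MonotoneOn (fun t => t ^ r - r * M ^ (r - 1) * t) (Set.Icc 0 M) := by
  have hcont : Continuous fun t : ℝ => t ^ r - r * M ^ (r - 1) * t :=
    (Real.continuous_rpow_const hr0.le).sub (continuous_const.mul continuous_id)
  have hderiv {t : ℝ} (ht : t ∈ interior (Set.Icc 0 M)) :
      HasDerivAt (fun t : ℝ => t ^ r - r * M ^ (r - 1) * t)
        (r * t ^ (r - 1) - r * M ^ (r - 1) * 1) t := by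
    rw [interior_Icc] at ht
    exact (Real.hasDerivAt_rpow_const (Or.inl ht.1.ne')).sub ((hasDerivAt_id t).const_mul _)
  refine monotoneOn_of_deriv_nonneg (convex_Icc 0 M) hcont.continuousOn
    (fun t ht => (hderiv ht).differentiableAt.differentiableWithinAt) fun t ht => ?_
  rw [(hderiv ht).deriv, mul_one, sub_nonneg]
  rw [interior_Icc] at ht
  gcongr r * ?_
  exact Real.rpow_le_rpow_of_nonpos ht.1 ht.2.le (by linarith)

lemma monotoneOn_Icc_neg_of_odd {g : ℝ → ℝ} (hodd : g.Odd) {M : ℝ}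
    (hg : MonotoneOn g (Set.Icc 0 M)) : MonotoneOn g (Set.Icc (-M) M) := by
  have hneg {s t : ℝ} (hs : -M ≤ s) (ht : t ≤ 0) (hst : s ≤ t) : g s ≤ g t := by
    have h := hg (a := -t) (b := -s) ⟨by linarith, by linarith⟩ ⟨by linarith, by linarith⟩
      (by linarith)
    rw [hodd t, hodd s] at h
    linarith
  intro s hs t ht hst
  rcases le_total 0 s with hs0 | hs0
  · exact hg ⟨hs0, hs.2⟩ ⟨hs0.trans hst, ht.2⟩ hst
  rcases le_total t 0 with ht0 | ht0
  · exact hneg hs.1 ht0 hst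
  · exact (hneg hs.1 le_rfl hs0).trans (hg ⟨le_rfl, ht0.trans ht.2⟩ ⟨ht0, ht.2⟩ ht0)

lemma monotoneOn_abs_rpow_mul_sub_mul (hp1 : 1 < p) (hp2 : p ≤ 2) (M : ℝ) :
    MonotoneOn (fun t => |t| ^ (p - 2) * t - (p - 1) * M ^ (p - 2) * t) (Set.Icc (-M) M) := by
  refine monotoneOn_Icc_neg_of_odd (fun t => ?_) ?_
  · simp only [abs_neg]
    ring
  · refine (monotoneOn_rpow_sub_mul (r := p - 1) (by linarith) (by linarith) M).congr
      fun t ht => ?_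
    have hpow : t ^ (p - 1) = |t| ^ (p - 2) * t := by
      rcases ht.1.eq_or_lt with rfl | ht0
      · simp [Real.zero_rpow (sub_pos.2 hp1).ne']
      · rw [abs_of_pos ht0, ← Real.rpow_add_one ht0.ne']
        ring_nf
    simp only [hpow]
    ring_nf

/-- The Bregman divergence of `|·|^p / p`. -/
noncomputable def bregman (p s a : ℝ) : ℝ := |s| ^ p / p - |a| ^ p / p - |a| ^ (p - 2) * a * (s - a)

lemma mul_sq_sub_le_bregman (hp1 : 1 < p) (hp2 : p ≤ 2) {M s a : ℝ} (hs : |s| ≤ M) (ha : |a| ≤ M) :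
    (p - 1) / 2 * M ^ (p - 2) * (s - a) ^ 2 ≤ bregman p s a := by
  have hp0 : p ≠ 0 := by linarith
  set F : ℝ → ℝ := fun t => |t| ^ p / p - (p - 1) * M ^ (p - 2) * (t ^ 2 / 2) with hF
  set F' : ℝ → ℝ := fun t => |t| ^ (p - 2) * t - (p - 1) * M ^ (p - 2) * t with hF'
  have hderiv (t : ℝ) : HasDerivAt F (F' t) t := by
    refine (((hasDerivAt_abs_rpow t hp1).div_const p).sub
      (((hasDerivAt_pow 2 t).div_const 2).const_mul ((p - 1) * M ^ (p - 2)))).congr_deriv ?_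
    simp only [hF']
    push_cast
    field
  have hconv : ConvexOn ℝ (Set.Icc (-M) M) F := by
    refine MonotoneOn.convexOn_of_deriv (convex_Icc _ _)
      (fun t _ => (hderiv t).continuousAt.continuousWithinAt)
      (fun t _ => (hderiv t).differentiableAt.differentiableWithinAt) ?_
    rw [show deriv F = F' from funext fun t => (hderiv t).deriv]
    exact (monotoneOn_abs_rpow_mul_sub_mul hp1 hp2 M).mono interior_subset
  have htangent : F a + F' a * (s - a) ≤ F s := by
    rcases lt_trichotomy a s with h | rfl | h
    · have := hconv.le_slope_of_hasDerivAt (abs_le.1 ha) (abs_le.1 hs) h (hderiv a)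
      rw [slope_def_field, le_div_iff₀ (by linarith)] at this
      linarith
    · simp
    · have := hconv.slope_le_of_hasDerivAt (abs_le.1 hs) (abs_le.1 ha) h (hderiv a)
      rw [slope_def_field, div_le_iff₀ (by linarith)] at this
      linarith
  simp only [hF, hF'] at htangent
  rw [bregman]
  linarith

lemma bregman_nonneg (hp1 : 1 < p) (hp2 : p ≤ 2) (s a : ℝ) : 0 ≤ bregman p s a := by
  have : 0 ≤ max |s| |a| := by positivity
  refine le_trans ?_ (mul_sq_sub_le_bregman hp1 hp2 (le_max_left |s| |a|) (le_max_right _ _))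
  have : 0 ≤ p - 1 := by linarith
  positivity

lemma abs_sub_rpow_le (hp1 : 1 < p) (hp2 : p ≤ 2) (s a : ℝ) :
    |s - a| ^ p ≤
      (2 / (p - 1) * bregman p s a) ^ (p / 2) * (|s| ^ p + |a| ^ p) ^ (1 - p / 2) := by
  have : 0 < p := by linarith
  have hpm : 0 < p - 1 := by linarith
  have hD := bregman_nonneg hp1 hp2 s a
  set M := max |s| |a| with hM
  have hM0 : 0 ≤ M := by positivity
  have hMp : M ^ p ≤ |s| ^ p + |a| ^ p := by
    rcases max_choice |s| |a| with h | h <;> rw [hM, h]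
    · exact le_add_of_nonneg_right (by positivity)
    · exact le_add_of_nonneg_left (by positivity)
  have hsq : (s - a) ^ 2 ≤ 2 / (p - 1) * bregman p s a * M ^ (2 - p) := by
    rcases hM0.eq_or_lt with h0 | h0
    · have hs : s = 0 := abs_nonpos_iff.1 (h0 ▸ le_max_left |s| |a|)
      have ha : a = 0 := abs_nonpos_iff.1 (h0 ▸ le_max_right |s| |a|)
      have hzero : (s - a) ^ 2 = 0 := by simp [hs, ha]
      rw [hzero]
      positivity
    · have h := mul_sq_sub_le_bregman hp1 hp2 (le_max_left |s| |a|) (le_max_right |s| |a|)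
      rw [← neg_sub 2 p, Real.rpow_neg hM0] at h
      rw [div_mul_eq_mul_div, div_mul_eq_mul_div, le_div_iff₀ hpm]
      field_simp at h
      linarith
  calc |s - a| ^ p = ((s - a) ^ 2) ^ (p / 2) := by
        rw [← sq_abs, ← Real.rpow_natCast, ← Real.rpow_mul (abs_nonneg _)]
        congr 1
        push_cast
        ring
    _ ≤ (2 / (p - 1) * bregman p s a * M ^ (2 - p)) ^ (p / 2) := by gcongr
    _ = (2 / (p - 1) * bregman p s a) ^ (p / 2) * (M ^ p) ^ (1 - p / 2) := by
        rw [Real.mul_rpow (by positivity) (by positivity), ← Real.rpow_mul hM0,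
          ← Real.rpow_mul hM0]
        ring_nf
    _ ≤ _ := by
        have : 0 ≤ 1 - p / 2 := by linarith
        gcongr

lemma sum_rpow_mul_rpow_le {ι : Type*} (s : Finset ι) {f g : ι → ℝ} (hf : ∀ i, 0 ≤ f i)
    (hg : ∀ i, 0 ≤ g i) {θ : ℝ} (hθ0 : 0 < θ) (hθ1 : θ < 1) :
    ∑ i ∈ s, f i ^ θ * g i ^ (1 - θ) ≤ (∑ i ∈ s, f i) ^ θ * (∑ i ∈ s, g i) ^ (1 - θ) := by
  have hθ' : 0 < 1 - θ := by linarith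
  have h := Real.inner_le_Lp_mul_Lq_of_nonneg s (f := fun i => f i ^ θ)
    (g := fun i => g i ^ (1 - θ)) (Real.HolderConjugate.inv_inv hθ0 hθ' (by ring))
    (fun i _ => Real.rpow_nonneg (hf i) _) (fun i _ => Real.rpow_nonneg (hg i) _)
  simpa only [one_div, inv_inv, Real.rpow_rpow_inv (hf _) hθ0.ne',
    Real.rpow_rpow_inv (hg _) hθ'.ne'] using h

lemma sum_bregman (hp : 1 < p) (x u : Fin n → ℝ) (hx : ellpNorm p x = 1) (hu : ellpNorm p u = 1) :
    ∑ i, bregman p (x i) (u i) = 1 - ∑ i, |u i| ^ (p - 2) * u i * x i := by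
  have hp0 : 0 < p := by linarith
  have hself (i : Fin n) : |u i| ^ (p - 2) * u i * u i = |u i| ^ p := by
    rcases eq_or_ne (u i) 0 with hi | hi
    · simp [hi, Real.zero_rpow hp0.ne']
    · rw [mul_assoc, ← sq, ← sq_abs, ← Real.rpow_natCast, ← Real.rpow_add (abs_pos.2 hi)]
      norm_num
  simp only [bregman, mul_sub, hself, Finset.sum_sub_distrib, ← Finset.sum_div,
    ← ellpNorm_rpow hp0, hx, hu, Real.one_rpow]
  ring

lemma ellpNorm_sub_le_of_sum_le (hp1 : 1 < p) (hp2 : p < 2) {x u : Fin n → ℝ}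
    (hx : ellpNorm p x = 1) (hu : ellpNorm p u = 1) {η : ℝ}
    (h : 1 - η ≤ ∑ i, |u i| ^ (p - 2) * u i * x i) :
    ellpNorm p (x - u) ≤ 2 * √(η / (p - 1)) := by
  have hp0 : 0 < p := by linarith
  have : 0 < p - 1 := by linarith
  have hD (i : Fin n) : 0 ≤ bregman p (x i) (u i) := bregman_nonneg hp1 hp2.le _ _
  have hsum : ∑ i, bregman p (x i) (u i) ≤ η := by
    rw [sum_bregman hp1 x u hx hu]
    linarith
  have hη : 0 ≤ η := (Finset.sum_nonneg fun i _ => hD i).trans hsum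
  refine ellpNorm_le_of_sum_le hp0 (by positivity) ?_
  calc ∑ i, |(x - u) i| ^ p
      ≤ ∑ i, (2 / (p - 1) * bregman p (x i) (u i)) ^ (p / 2) *
          (|x i| ^ p + |u i| ^ p) ^ (1 - p / 2) :=
        Finset.sum_le_sum fun i _ => abs_sub_rpow_le hp1 hp2.le (x i) (u i)
    _ ≤ (∑ i, 2 / (p - 1) * bregman p (x i) (u i)) ^ (p / 2) *
          (∑ i, (|x i| ^ p + |u i| ^ p)) ^ (1 - p / 2) :=
        sum_rpow_mul_rpow_le _ (fun i => mul_nonneg (by positivity) (hD i))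
          (fun i => by positivity) (by linarith) (by linarith)
    _ ≤ (2 / (p - 1) * η) ^ (p / 2) * 2 ^ (1 - p / 2) := by
        rw [← Finset.mul_sum, Finset.sum_add_distrib, ← ellpNorm_rpow hp0, ← ellpNorm_rpow hp0,
          hx, hu, Real.one_rpow, one_add_one_eq_two]
        have : 0 ≤ ∑ i, bregman p (x i) (u i) := Finset.sum_nonneg fun i _ => hD i
        gcongr
    _ = 2 * (η / (p - 1)) ^ (p / 2) := by
        rw [div_mul_eq_mul_div, mul_div_assoc, Real.mul_rpow zero_le_two (by positivity),
          mul_right_comm, ← Real.rpow_add two_pos, add_sub_cancel, Real.rpow_one]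
    _ ≤ (2 * √(η / (p - 1))) ^ p := by
        rw [Real.mul_rpow zero_le_two (by positivity), Real.sqrt_eq_rpow,
          ← Real.rpow_mul (by positivity), one_div_mul_eq_div]
        gcongr
        simpa using Real.rpow_le_rpow_of_exponent_le one_le_two hp1.le

/-- The vector of unit `ℓ_p`-norm at which `w` attains its `ℓ_q`-norm, for conjugate `p` and `q`. -/
noncomputable def dualVec (p q : ℝ) (w : Fin n → ℝ) : Fin n → ℝ :=
  fun j => sgn (w j) * (|w j| ^ q / ellpNorm q w ^ q) ^ (1 / p)

lemma abs_sgn (a : ℝ) : |sgn a| = 1 := by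
  unfold sgn
  split_ifs <;> norm_num

lemma sgn_mul_abs (a : ℝ) : sgn a * |a| = a := by
  unfold sgn
  split_ifs with h
  · rw [abs_of_nonneg h, one_mul]
  · rw [abs_of_neg (not_le.1 h), neg_one_mul, neg_neg]

lemma abs_dualVec (p q : ℝ) (w : Fin n → ℝ) (j : Fin n) :
    |dualVec p q w j| = (|w j| ^ q / ellpNorm q w ^ q) ^ (1 / p) := by
  have := ellpNorm_nonneg q w
  rw [dualVec, abs_mul, abs_sgn, one_mul, abs_of_nonneg (by positivity)]

lemma ellpNorm_dualVec (hp : 0 < p) (hq : 0 < q) {w : Fin n → ℝ} (hw : 0 < ellpNorm q w) :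
    ellpNorm p (dualVec p q w) = 1 := by
  have hpow (j : Fin n) : |dualVec p q w j| ^ p = |w j| ^ q / ellpNorm q w ^ q := by
    rw [abs_dualVec, ← Real.rpow_mul (by positivity), one_div_mul_cancel hp.ne', Real.rpow_one]
  rw [ellpNorm]
  simp only [hpow]
  rw [← Finset.sum_div, ← ellpNorm_rpow hq, div_self (by positivity), Real.one_rpow]

lemma abs_dualVec_rpow_mul_self (hpq : p.HolderConjugate q) {w : Fin n → ℝ}
    (hw : 0 < ellpNorm q w) (j : Fin n) :
    |dualVec p q w j| ^ (p - 2) * dualVec p q w j = w j / ellpNorm q w := by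
  rcases eq_or_ne (w j) 0 with hj | hj
  · simp [dualVec, hj, hpq.symm.pos.ne', hpq.pos.ne']
  have hpos : 0 < |w j| / ellpNorm q w := by positivity
  have hbase : (|w j| ^ q / ellpNorm q w ^ q) ^ (1 / p) = (|w j| / ellpNorm q w) ^ (q / p) := by
    rw [← Real.div_rpow (abs_nonneg _) hw.le, ← Real.rpow_mul hpos.le, mul_one_div]
  have hexp : q / p * (p - 1) = 1 := by
    rw [div_mul_eq_mul_div, mul_comm, hpq.sub_one_mul_conj, div_self hpq.ne_zero]
  rw [abs_dualVec, dualVec, hbase, mul_left_comm, ← Real.rpow_add_one (by positivity),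
    show p - 2 + 1 = p - 1 by ring, ← Real.rpow_mul hpos.le, hexp, Real.rpow_one, mul_div_assoc',
    sgn_mul_abs]

lemma ellpNorm_sub_dualVec_le (hp2 : p < 2) (hpq : p.HolderConjugate q) {w x : Fin n → ℝ}
    (hw : 0 < ellpNorm q w) (hx : ellpNorm p x = 1) {η : ℝ}
    (h : (1 - η) * ellpNorm q w ≤ w ⬝ᵥ x) :
    ellpNorm p (x - dualVec p q w) ≤ 2 * √(η / (p - 1)) := by
  refine ellpNorm_sub_le_of_sum_le hpq.lt hp2 hx (ellpNorm_dualVec hpq.pos hpq.symm.pos hw) ?_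
  simp only [abs_dualVec_rpow_mul_self hpq hw, div_mul_eq_mul_div, ← Finset.sum_div]
  exact (le_div_iff₀ hw).2 h

end HolderStability

section ScalarOptimization

variable {n : ℕ} {p c : ℝ}

lemma le_one_of_rpow_eq_half (hp : 0 < p) (hc0 : 0 ≤ c) (hc : c ^ p = 1 / 2) : c ≤ 1 := by
  rw [← Real.rpow_le_rpow_iff hc0 zero_le_one hp, hc, Real.one_rpow]
  norm_num

lemma half_le_of_rpow_eq_half (hp : 1 ≤ p) (hc0 : 0 ≤ c) (hc : c ^ p = 1 / 2) : 1 / 2 ≤ c := by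
  rw [← Real.rpow_le_rpow_iff (by norm_num) hc0 (zero_lt_one.trans_le hp), hc]
  simpa using Real.rpow_le_rpow_of_exponent_ge (x := 1 / 2) (by norm_num) (by norm_num) hp

lemma abs_sub_le_two_mul_abs_rpow_sub (hp : 1 ≤ p) (hc0 : 0 ≤ c) (hc : c ^ p = 1 / 2) {t : ℝ}
    (ht : 0 ≤ t) : |t - c| ≤ 2 * |t ^ p - 1 / 2| := by
  have hc_half := half_le_of_rpow_eq_half hp hc0 hc
  have hc_pow : 1 / 2 ≤ c ^ (p - 1) := by
    have hc1 := le_one_of_rpow_eq_half (by linarith) hc0 hc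
    have hmul : c ^ p = c * c ^ (p - 1) := by
      rw [← Real.rpow_one_add' hc0 (by linarith), add_sub_cancel]
    have : 0 ≤ c ^ (p - 1) := by positivity
    nlinarith
  have hmul {s : ℝ} (hs : 0 ≤ s) : s ^ p = s * s ^ (p - 1) := by
    rw [← Real.rpow_one_add' hs (by linarith), add_sub_cancel]
  rw [← hc, hmul ht, hmul hc0]
  rcases le_total c t with h | h
  · have hpow : c ^ (p - 1) ≤ t ^ (p - 1) := by gcongr
    rw [abs_of_nonneg (by linarith)]
    refine le_trans ?_ (mul_le_mul_of_nonneg_left (le_abs_self _) zero_le_two)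
    nlinarith
  · have hpow : t ^ (p - 1) ≤ c ^ (p - 1) := by gcongr
    rw [abs_of_nonpos (by linarith)]
    refine le_trans ?_ (mul_le_mul_of_nonneg_left (neg_le_abs _) zero_le_two)
    nlinarith

lemma ellpNorm_two_rpow_le (hp0 : 0 < p) (hp2 : p ≤ 2) {y : Fin n → ℝ} {m : ℝ} (hm0 : 0 ≤ m)
    (hm : ∀ i, |y i| ≤ m) :
    ellpNorm 2 y ^ p ≤ (1 - p / 2) * m ^ p + p / 2 * ellpNorm p y ^ p := by
  have hsum : ∑ i, y i ^ 2 ≤ m ^ (2 - p) * ellpNorm p y ^ p := by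
    rw [ellpNorm_rpow hp0, Finset.mul_sum]
    refine Finset.sum_le_sum fun i _ => ?_
    calc y i ^ 2 = |y i| ^ (2 - p) * |y i| ^ p := by
          rw [← Real.rpow_add_of_nonneg (abs_nonneg _) (by linarith) hp0.le, sub_add_cancel]
          simp
      _ ≤ m ^ (2 - p) * |y i| ^ p := by
          gcongr
          exact hm i
  have hpow : 0 ≤ ellpNorm p y ^ p := Real.rpow_nonneg (ellpNorm_nonneg p y) p
  calc ellpNorm 2 y ^ p = (∑ i, y i ^ 2) ^ (p / 2) := by
        rw [← ellpNorm_two_sq, ← Real.rpow_natCast_mul (ellpNorm_nonneg 2 y)]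
        congr 1
        push_cast
        ring
    _ ≤ (m ^ (2 - p) * ellpNorm p y ^ p) ^ (p / 2) := by gcongr
    _ = (m ^ p) ^ (1 - p / 2) * (ellpNorm p y ^ p) ^ (p / 2) := by
        rw [Real.mul_rpow (by positivity) hpow, ← Real.rpow_mul hm0, ← Real.rpow_mul hm0]
        ring_nf
    _ ≤ _ := Real.geom_mean_le_arith_mean2_weighted (by linarith) (by positivity) (by positivity)
        hpow (by ring)

lemma ellpNorm_mul_ellpNorm_le (hp : 0 < p) (hc0 : 0 ≤ c) (hc : c ^ p = 1 / 2) {y z : Fin n → ℝ}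
    (hyz : ellpNorm p y ^ p + ellpNorm p z ^ p = 1) : ellpNorm p y * ellpNorm p z ≤ c ^ 2 := by
  have hy := ellpNorm_nonneg p y
  have hz := ellpNorm_nonneg p z
  rw [← Real.rpow_le_rpow_iff (by positivity) (by positivity) hp, Real.mul_rpow hy hz,
    ← Real.rpow_pow_comm hc0, hc]
  rw [← eq_sub_iff_add_eq'] at hyz
  rw [hyz]
  linarith [sq_nonneg (ellpNorm p y ^ p - 1 / 2)]

lemma sq_sub_half_add_le (hp1 : 1 ≤ p) (hp2 : p ≤ 2) (hc0 : 0 ≤ c) (hc : c ^ p = 1 / 2)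
    {y z : Fin n → ℝ} (hyz : ellpNorm p y ^ p + ellpNorm p z ^ p = 1) {m : ℝ} (hm0 : 0 ≤ m)
    (hm : ∀ i, |y i| ≤ m) {η : ℝ} (hη0 : 0 ≤ η) (hη1 : η ≤ 1)
    (h : c ^ 2 * (1 - η) ≤ ellpNorm p z * ellpNorm 2 y) :
    (ellpNorm p y ^ p - 1 / 2) ^ 2 +
      (1 - p / 2) * (ellpNorm p y ^ p - m ^ p) * ellpNorm p z ^ p ≤ η / 2 := by
  have hZ := ellpNorm_nonneg p z
  have hbernoulli : 1 - 2 * η ≤ (1 - η) ^ p := by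
    have := one_add_mul_self_le_rpow_one_add (s := -η) (by linarith) hp1
    rw [← sub_eq_add_neg] at this
    nlinarith
  have hpow : 1 / 4 * (1 - η) ^ p ≤
      ellpNorm p z ^ p * ((1 - p / 2) * m ^ p + p / 2 * ellpNorm p y ^ p) := by
    calc 1 / 4 * (1 - η) ^ p = (c ^ 2 * (1 - η)) ^ p := by
          rw [Real.mul_rpow (by positivity) (by linarith), ← Real.rpow_pow_comm hc0, hc]
          norm_num
      _ ≤ (ellpNorm p z * ellpNorm 2 y) ^ p := by
          have : 0 ≤ 1 - η := by linarith
          gcongr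
      _ = ellpNorm p z ^ p * ellpNorm 2 y ^ p := Real.mul_rpow hZ (ellpNorm_nonneg 2 y)
      _ ≤ _ := by grw [ellpNorm_two_rpow_le (by linarith) hp2 hm0 hm]
  rw [← eq_sub_iff_add_eq'] at hyz
  rw [hyz] at hpow ⊢
  linarith

end ScalarOptimization

section DominantCoordinate

variable {n : ℕ} {p q c : ℝ}

lemma ellpNorm_sub_smul_basisVec_rpow (hp : 0 < p) (y : Fin n → ℝ) (i : Fin n) :
    ellpNorm p (y - y i • basisVec i) ^ p = ellpNorm p y ^ p - |y i| ^ p := by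
  rw [ellpNorm_rpow hp, ellpNorm_rpow hp, ← Finset.sum_erase_add _ _ (Finset.mem_univ i),
    ← Finset.sum_erase_add _ (fun j => |y j| ^ p) (Finset.mem_univ i), add_sub_cancel_right]
  have hi : |(y - y i • basisVec i) i| ^ p = 0 := by simp [basisVec, Real.zero_rpow hp.ne']
  rw [hi, add_zero]
  refine Finset.sum_congr rfl fun j hj => ?_
  simp [basisVec, Finset.ne_of_mem_erase hj]

lemma exists_dominant_coordinate (hn : 0 < n) (hp1 : 1 ≤ p) (hp2 : p < 2) (hc0 : 0 ≤ c)
    (hc : c ^ p = 1 / 2) {y z : Fin n → ℝ} (hyz : ellpNorm p y ^ p + ellpNorm p z ^ p = 1) {ε : ℝ}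
    (hε0 : 0 ≤ ε) (hε : ε ≤ 1 / 4) (h : c ^ 2 * (1 - ε ^ 2) ≤ ellpNorm p z * ellpNorm 2 y) :
    |ellpNorm p z - c| ≤ 2 * ε ∧ ∃ i, |(|y i|) - c| ≤ 2 * ε + 8 / (2 - p) * ε ^ 2 ∧
      ellpNorm p (y - y i • basisVec i) ^ p ≤ 4 / (2 - p) * ε ^ 2 := by
  have hp0 : 0 < p := by linarith
  have h2p : 0 < 2 - p := by linarith
  have : Nonempty (Fin n) := Fin.pos_iff_nonempty.1 hn
  obtain ⟨i, hi⟩ := Finite.exists_max (fun i => |y i|)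
  have hstab := sq_sub_half_add_le hp1 hp2.le hc0 hc hyz (abs_nonneg (y i)) hi (sq_nonneg ε)
    (by nlinarith) h
  have hrest : 0 ≤ ellpNorm p y ^ p - |y i| ^ p := by
    grw [abs_le_ellpNorm hp0 y i, sub_self]
  have hzp : 0 ≤ ellpNorm p z ^ p := Real.rpow_nonneg (ellpNorm_nonneg p z) p
  have hhalf : |ellpNorm p y ^ p - 1 / 2| ≤ ε := by
    refine abs_le_of_sq_le_sq ?_ hε0
    have : 0 ≤ (1 - p / 2) * (ellpNorm p y ^ p - |y i| ^ p) * ellpNorm p z ^ p :=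
      mul_nonneg (mul_nonneg (by linarith) hrest) hzp
    nlinarith
  have hrest_le : ellpNorm p y ^ p - |y i| ^ p ≤ 4 / (2 - p) * ε ^ 2 := by
    have hz_quarter : 1 / 4 ≤ ellpNorm p z ^ p := by
      linarith [le_abs_self (ellpNorm p y ^ p - 1 / 2)]
    have := mul_le_mul_of_nonneg_left hz_quarter (mul_nonneg h2p.le hrest)
    rw [div_mul_eq_mul_div, le_div_iff₀ h2p]
    nlinarith [sq_nonneg (ellpNorm p y ^ p - 1 / 2)]
  refine ⟨?_, i, ?_, (ellpNorm_sub_smul_basisVec_rpow hp0 y i).trans_le hrest_le⟩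
  · refine (abs_sub_le_two_mul_abs_rpow_sub hp1 hc0 hc (ellpNorm_nonneg p z)).trans ?_
    rw [← eq_sub_iff_add_eq'] at hyz
    rw [hyz, show 1 - ellpNorm p y ^ p - 1 / 2 = -(ellpNorm p y ^ p - 1 / 2) by ring, abs_neg]
    linarith
  · refine (abs_sub_le_two_mul_abs_rpow_sub hp1 hc0 hc (abs_nonneg (y i))).trans ?_
    have hm : |(|y i| ^ p) - 1 / 2| ≤ ε + 4 / (2 - p) * ε ^ 2 := by
      rw [abs_le] at hhalf ⊢
      constructor <;> linarith [show 0 ≤ 4 / (2 - p) * ε ^ 2 by positivity]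
    grw [hm]
    exact le_of_eq (by ring)

lemma le_mul_row_dotProduct {A : Matrix (Fin n) (Fin n) ℝ} {y z : Fin n → ℝ} {N e ρ η : ℝ}
    (hcol : ∀ u : Fin n → ℝ, (∀ j, |u j| ≤ |y j|) →
      u ⬝ᵥ A *ᵥ z ≤ ellpNorm p z * ellpNorm 2 u * N + e)
    (hlow : c ^ 2 * (1 - η) * N + 2 * e ≤ y ⬝ᵥ A *ᵥ z) (hz : ellpNorm p z ≤ 1) (hN : 0 ≤ N)
    {i : Fin n} (hy : ellpNorm 2 (y - y i • basisVec i) ≤ ρ) :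
    c ^ 2 * (1 - η) * N - ρ * N + e ≤ y i * (A i ⬝ᵥ z) := by
  have hsplit : y ⬝ᵥ A *ᵥ z = y i * (A i ⬝ᵥ z) + (y - y i • basisVec i) ⬝ᵥ A *ᵥ z := by
    rw [sub_dotProduct, smul_dotProduct, basisVec, single_one_dotProduct, smul_eq_mul]
    exact (add_sub_cancel _ _).symm
  have hrest := hcol (y - y i • basisVec i) fun j => by
    rcases eq_or_ne j i with rfl | hj
    · simp [basisVec]
    · simp [basisVec, hj]
  have : ellpNorm p z * ellpNorm 2 (y - y i • basisVec i) * N ≤ 1 * ρ * N := by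
    have := ellpNorm_nonneg 2 (y - y i • basisVec i)
    gcongr
  linarith

lemma pos_of_mul_dotProduct_pos (hpq : p.HolderConjugate q) {s : ℝ} {w z : Fin n → ℝ}
    (h : 0 < s * (w ⬝ᵥ z)) : 0 < |s| ∧ 0 < ellpNorm q w ∧ 0 < ellpNorm p z := by
  have hw := ellpNorm_nonneg q w
  have hz := ellpNorm_nonneg p z
  have hs : s ≠ 0 := left_ne_zero_of_mul h.ne'
  have hneg := dotProduct_le_ellpNorm_mul hpq.symm w (-z)
  rw [dotProduct_neg, ellpNorm_neg] at hneg
  have habs : |w ⬝ᵥ z| ≤ ellpNorm q w * ellpNorm p z :=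
    abs_le.2 ⟨by linarith, dotProduct_le_ellpNorm_mul hpq.symm w z⟩
  have hpos := (abs_pos.2 (right_ne_zero_of_mul h.ne')).trans_le habs
  exact ⟨abs_pos.2 hs, hw.lt_of_ne' (left_ne_zero_of_mul hpos.ne'),
    hz.lt_of_ne' (right_ne_zero_of_mul hpos.ne')⟩

lemma ellpNorm_smul_div_sub_dualVec_le (hp2 : p < 2) (hpq : p.HolderConjugate q) (hc0 : 0 < c)
    (hc1 : c ≤ 1) {w z : Fin n → ℝ} {s N e η : ℝ} (hsz : |s| * ellpNorm p z ≤ c ^ 2)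
    (hw : ellpNorm q w ≤ N + e) (hN : 0 < N) (he : 0 ≤ e) (hη0 : 0 ≤ η) (hη1 : η < 1)
    (h : c ^ 2 * (1 - η) * N + e ≤ s * (w ⬝ᵥ z)) :
    ellpNorm p ((sgn s / ellpNorm p z) • z - dualVec p q w) ≤ 2 * √(η / (p - 1)) := by
  have : 0 < 1 - η := by linarith
  obtain ⟨hs, hw_pos, hz_pos⟩ :=
    pos_of_mul_dotProduct_pos hpq (h.trans_lt' (by positivity))
  refine ellpNorm_sub_dualVec_le hp2 hpq hw_pos ?_ ?_
  · rw [ellpNorm_smul hpq.pos, abs_div, abs_sgn, abs_of_pos hz_pos, one_div_mul_cancel hz_pos.ne']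
  · rw [dotProduct_smul, smul_eq_mul, div_mul_eq_mul_div, le_div_iff₀ hz_pos]
    refine le_of_mul_le_mul_left ?_ hs
    calc |s| * ((1 - η) * ellpNorm q w * ellpNorm p z)
        = (1 - η) * (|s| * ellpNorm p z) * ellpNorm q w := by ring
      _ ≤ (1 - η) * c ^ 2 * (N + e) := by gcongr
      _ = c ^ 2 * (1 - η) * N + (1 - η) * c ^ 2 * e := by ring
      _ ≤ c ^ 2 * (1 - η) * N + 1 * 1 ^ 2 * e := by
          gcongr
          linarith
      _ ≤ s * (w ⬝ᵥ z) := by linarith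
      _ = |s| * (sgn s * (w ⬝ᵥ z)) := by
          rw [← mul_assoc, mul_comm |s|, sgn_mul_abs]

lemma ellpNorm_add_sub_smul_le (hp : 1 ≤ p) {y z u : Fin n → ℝ} (hz0 : ellpNorm p z ≠ 0)
    (hz1 : ellpNorm p z ≤ 1) (hu : ellpNorm p u = 1) (c : ℝ) (i : Fin n) :
    ellpNorm p (y + z - (c * sgn (y i)) • (basisVec i + u)) ≤
      ellpNorm p (y - y i • basisVec i) + |(|y i|) - c| +
        (ellpNorm p ((sgn (y i) / ellpNorm p z) • z - u) + |ellpNorm p z - c|) := by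
  have hp0 : 0 < p := by linarith
  set σ := sgn (y i) with hσ
  set Z := ellpNorm p z
  have hσ_sq : σ * σ = 1 := by rw [← abs_mul_abs_self, abs_sgn, one_mul]
  have hz : z = (σ * Z) • (σ / Z) • z := by
    rw [smul_smul, show σ * Z * (σ / Z) = σ * σ * (Z / Z) by ring, hσ_sq, div_self hz0, mul_one,
      one_smul]
  have hdecomp : y + z - (c * σ) • (basisVec i + u) =
      y - y i • basisVec i + (σ * (|y i| - c)) • basisVec i +
        ((σ * Z) • ((σ / Z) • z - u) + (σ * (Z - c)) • u) := by
    rw [smul_sub, ← hz, mul_sub, hσ, sgn_mul_abs]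
    module
  have hσ_abs : |σ| = 1 := abs_sgn _
  have hscale : ellpNorm p ((σ * Z) • ((σ / Z) • z - u)) ≤ ellpNorm p ((σ / Z) • z - u) := by
    rw [ellpNorm_smul hp0, abs_mul, hσ_abs, one_mul, abs_of_nonneg (ellpNorm_nonneg p z)]
    exact mul_le_of_le_one_left (ellpNorm_nonneg p _) hz1
  rw [hdecomp]
  grw [ellpNorm_add_le hp, ellpNorm_add_le hp (y - y i • basisVec i), ellpNorm_add_le hp (_ • _),
    hscale]
  rw [ellpNorm_smul hp0, ellpNorm_smul hp0, abs_mul, abs_mul, hσ_abs, ellpNorm_basisVec hp0, hu,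
    one_mul, one_mul, mul_one, mul_one]

end DominantCoordinate

section Stability

variable {n : ℕ} {p q : ℝ}

/-- If the value of the quadratic form falls short of its maximum by a factor `1 - τ ^ 4`, then the
pairing of the light part with the dominant row falls short of the norm of that row by a factor
`1 - alignmentConst p * τ ^ 2`. -/
noncomputable def alignmentConst (p : ℝ) : ℝ := 1 + 4 * √(4 / (2 - p))

/-- The ratio between the distance to a near-optimizer and `τ` when the value of the quadratic form
falls short of its maximum by a factor `1 - τ ^ 4`. -/
noncomputable def stabilityConst (p : ℝ) : ℝ :=
  4 + √(4 / (2 - p)) + 8 / (2 - p) + 2 * √(alignmentConst p / (p - 1))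

lemma alignmentConst_ge (hp0 : 0 ≤ p) (hp2 : p < 2) : 5 ≤ alignmentConst p := by
  have : 1 ≤ √(4 / (2 - p)) := by
    rw [Real.one_le_sqrt, one_le_div (by linarith)]
    linarith
  rw [alignmentConst]
  linarith

lemma stabilityConst_pos (hp : p < 2) : 0 < stabilityConst p := by
  have : 0 < 2 - p := by linarith
  unfold stabilityConst
  positivity

lemma ellpNorm_le_sqrt_mul_sq (hp1 : 1 ≤ p) (hp2 : p < 2) {x : Fin n → ℝ} {τ : ℝ}
    (hτ : alignmentConst p * τ ^ 2 ≤ 1) (hx : ellpNorm p x ^ p ≤ 4 / (2 - p) * (τ ^ 2) ^ 2) :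
    ellpNorm p x ≤ √(4 / (2 - p)) * τ ^ 2 := by
  have h2p : 0 < 2 - p := by linarith
  set ρ := √(4 / (2 - p)) * τ ^ 2 with hρ
  have hρ0 : 0 ≤ ρ := by positivity
  have hρ1 : ρ ≤ 1 := by
    rw [alignmentConst] at hτ
    nlinarith [sq_nonneg τ]
  rw [← Real.rpow_le_rpow_iff (ellpNorm_nonneg p x) hρ0 (zero_lt_one.trans_le hp1)]
  calc ellpNorm p x ^ p ≤ ρ ^ 2 := by rwa [hρ, mul_pow, Real.sq_sqrt (by positivity)]
    _ ≤ ρ ^ p := by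
      rw [← Real.rpow_natCast]
      exact Real.rpow_le_rpow_of_exponent_ge_of_imp hρ0 hρ1 (mod_cast hp2.le)
        fun _ h => by norm_num at h

lemma ellpNorm_le_one_of_rpow_add_rpow_eq_one (hp : 0 < p) {y z : Fin n → ℝ}
    (hyz : ellpNorm p y ^ p + ellpNorm p z ^ p = 1) : ellpNorm p z ≤ 1 := by
  rw [← Real.rpow_le_rpow_iff (ellpNorm_nonneg p z) zero_le_one hp, Real.one_rpow, ← hyz]
  exact le_add_of_nonneg_left (Real.rpow_nonneg (ellpNorm_nonneg p y) p)

variable {c : ℝ} {A : Matrix (Fin n) (Fin n) ℝ} {y z : Fin n → ℝ} {N e τ : ℝ}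

lemma exists_aligned_coordinate (hn : 0 < n) (hp1 : 1 ≤ p) (hp2 : p < 2) (hc0 : 0 ≤ c)
    (hc : c ^ p = 1 / 2) (hyz : ellpNorm p y ^ p + ellpNorm p z ^ p = 1) (hN : 0 < N) (he : 0 ≤ e)
    (hτ : alignmentConst p * τ ^ 2 ≤ 1)
    (hcol : ∀ u : Fin n → ℝ, (∀ j, |u j| ≤ |y j|) →
      u ⬝ᵥ A *ᵥ z ≤ ellpNorm p z * ellpNorm 2 u * N + e)
    (hlow : c ^ 2 * (1 - τ ^ 4) * N + 2 * e ≤ y ⬝ᵥ A *ᵥ z) :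
    |ellpNorm p z - c| ≤ 2 * τ ^ 2 ∧ ∃ i, |(|y i|) - c| ≤ 2 * τ ^ 2 + 8 / (2 - p) * τ ^ 4 ∧
      ellpNorm p (y - y i • basisVec i) ≤ √(4 / (2 - p)) * τ ^ 2 ∧
      c ^ 2 * (1 - alignmentConst p * τ ^ 2) * N + e ≤ y i * (A i ⬝ᵥ z) := by
  have hp0 : 0 < p := by linarith
  have hB := alignmentConst_ge hp0.le hp2
  have hτ_sq : τ ^ 2 ≤ 1 / 4 := by nlinarith [sq_nonneg τ]
  have hpow : (τ ^ 2) ^ 2 = τ ^ 4 := by ring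
  have hopt : c ^ 2 * (1 - (τ ^ 2) ^ 2) ≤ ellpNorm p z * ellpNorm 2 y := by
    refine le_of_mul_le_mul_right ?_ hN
    rw [hpow]
    linarith [hcol y fun _ => le_rfl]
  obtain ⟨hzc, i, hyc, hrest⟩ :=
    exists_dominant_coordinate hn hp1 hp2 hc0 hc hyz (sq_nonneg τ) hτ_sq hopt
  replace hrest := ellpNorm_le_sqrt_mul_sq hp1 hp2 hτ hrest
  refine ⟨hzc, i, by rwa [hpow] at hyc, hrest, le_trans ?_ <|
    le_mul_row_dotProduct hcol hlow (ellpNorm_le_one_of_rpow_add_rpow_eq_one hp0 hyz) hN.le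
      ((ellpNorm_anti hp0 hp2.le _).trans hrest)⟩
  rw [← sub_mul]
  gcongr ?_ * N + e
  have hc_sq : 1 / 4 ≤ c ^ 2 := by
    have := half_le_of_rpow_eq_half hp1 hc0 hc
    nlinarith
  have hτ_four : τ ^ 4 ≤ τ ^ 2 := by nlinarith [sq_nonneg τ]
  have : 1 / 4 * (√(4 / (2 - p)) * τ ^ 2) ≤ c ^ 2 * (√(4 / (2 - p)) * τ ^ 2) := by gcongr
  rw [alignmentConst]
  nlinarith

lemma exists_ellpNorm_add_sub_le (hn : 0 < n) (hp2 : p < 2) (hpq : p.HolderConjugate q)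
    (hc0 : 0 < c) (hc : c ^ p = 1 / 2) (hyz : ellpNorm p y ^ p + ellpNorm p z ^ p = 1)
    (hN : 0 < N) (he : 0 ≤ e) (hτ0 : 0 ≤ τ) (hτ : alignmentConst p * τ ^ 2 < 1)
    (hrow : ∀ i, ellpNorm q (A i) ≤ N + e)
    (hcol : ∀ u : Fin n → ℝ, (∀ j, |u j| ≤ |y j|) →
      u ⬝ᵥ A *ᵥ z ≤ ellpNorm p z * ellpNorm 2 u * N + e)
    (hlow : c ^ 2 * (1 - τ ^ 4) * N + 2 * e ≤ y ⬝ᵥ A *ᵥ z) :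
    ∃ i σ, |σ| = 1 ∧ ellpNorm p (y + z - (c * σ) • (basisVec i + dualVec p q (A i))) ≤
      stabilityConst p * τ := by
  have hp0 : 0 < p := hpq.pos
  have hp1 : 1 ≤ p := hpq.lt.le
  have h2p : 0 < 2 - p := by linarith
  have hB := alignmentConst_ge hp0.le hp2
  have hz1 := ellpNorm_le_one_of_rpow_add_rpow_eq_one hp0 hyz
  obtain ⟨hzc, i, hyc, hrest, halign⟩ :=
    exists_aligned_coordinate hn hp1 hp2 hc0.le hc hyz hN he hτ.le hcol hlow
  have hyz_le : |y i| * ellpNorm p z ≤ c ^ 2 := by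
    refine le_trans ?_ (ellpNorm_mul_ellpNorm_le hp0 hc0.le hc hyz)
    grw [abs_le_ellpNorm hp0 y i]
    exact ellpNorm_nonneg p z
  obtain ⟨-, hw, hz0⟩ := pos_of_mul_dotProduct_pos hpq <| halign.trans_lt' <| by
    have : 0 < 1 - alignmentConst p * τ ^ 2 := by linarith
    positivity
  have hdual := ellpNorm_smul_div_sub_dualVec_le hp2 hpq hc0 (le_one_of_rpow_eq_half hp0 hc0.le hc)
    hyz_le (hrow i) hN he (by positivity) hτ halign
  refine ⟨i, sgn (y i), abs_sgn _, (ellpNorm_add_sub_smul_le hp1 hz0.ne' hz1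
    (ellpNorm_dualVec hp0 hpq.symm.pos hw) c i).trans ?_⟩
  have hsqrt : √(alignmentConst p * τ ^ 2 / (p - 1)) = √(alignmentConst p / (p - 1)) * τ := by
    rw [mul_div_right_comm, Real.sqrt_mul, Real.sqrt_sq hτ0]
    have := hpq.sub_one_pos
    positivity
  have hτ1 : τ ≤ 1 := by nlinarith
  grw [hrest, hyc, hdual, hzc, hsqrt]
  have hτ_sq : τ ^ 2 ≤ τ := pow_le_of_le_one hτ0 hτ1 two_ne_zero
  have hτ_four : τ ^ 4 ≤ τ := pow_le_of_le_one hτ0 hτ1 four_ne_zero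
  grw [hτ_sq, hτ_four, stabilityConst]
  exact le_of_eq (by ring)

end Stability

section NearOptimizers

variable {n : ℕ} {p : ℝ}

lemma ellpDist_le (p : ℝ) (x : Fin n → ℝ) {S : Set (Fin n → ℝ)} {y : Fin n → ℝ} (hy : y ∈ S) :
    ellpDist p x S ≤ ellpNorm p (x - y) := by
  refine csInf_le ⟨0, ?_⟩ ⟨y, hy, rfl⟩
  rintro _ ⟨w, _, rfl⟩
  exact ellpNorm_nonneg p _

lemma ellpNorm_sub_normalize_le (hp : 1 ≤ p) {x u : Fin n → ℝ} (hx : ellpNorm p x = 1)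
    {c ε : ℝ} (hc : 0 ≤ c) (hε : ε < 1) (h : ellpNorm p (x - c • u) ≤ ε) :
    ellpNorm p (x - (1 / ellpNorm p u) • u) ≤ 2 * ε := by
  have hp0 : 0 < p := by linarith
  have hcu : ellpNorm p (c • u) = c * ellpNorm p u := by
    rw [ellpNorm_smul hp0, abs_of_nonneg hc]
  have hlower : 1 - ε ≤ c * ellpNorm p u := by
    have := ellpNorm_add_le hp (x - c • u) (c • u)
    rw [sub_add_cancel, hx, hcu] at this
    linarith
  have hupper : c * ellpNorm p u ≤ 1 + ε := by
    have := ellpNorm_add_le hp x (-(x - c • u))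
    rw [ellpNorm_neg, hx, neg_sub, add_sub_cancel, hcu] at this
    linarith
  have hu : 0 < ellpNorm p u := pos_of_mul_pos_right (by linarith) hc
  calc ellpNorm p (x - (1 / ellpNorm p u) • u)
      = ellpNorm p ((x - c • u) + (c - 1 / ellpNorm p u) • u) := by
        rw [sub_smul, sub_add_sub_cancel]
    _ ≤ ellpNorm p (x - c • u) + |c * ellpNorm p u - 1| := by
        refine (ellpNorm_add_le hp _ _).trans_eq ?_
        rw [ellpNorm_smul hp0, ← abs_of_pos hu, ← abs_mul, abs_of_pos hu, sub_mul,
          one_div_mul_cancel hu.ne']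
    _ ≤ ε + ε := by
        gcongr
        exact abs_sub_le_iff.2 ⟨by linarith, by linarith⟩
    _ = 2 * ε := (two_mul ε).symm

lemma symm_mulVec_basisVec (G : Matrix (Fin n) (Fin n) ℝ) (i : Fin n) :
    symm G *ᵥ basisVec i = symm G i := by
  ext j
  simp [basisVec, symm, add_comm, mul_add]

lemma v_eq_dualVec (p : ℝ) (G : Matrix (Fin n) (Fin n) ℝ) (i : Fin n) :
    v p G i = dualVec p (Real.conjExponent p) (symm G i) := by
  ext j
  simp only [v, dualVec, symm_mulVec_basisVec]

lemma ellpDist_nearOptimizers_le (hp : 1 ≤ p) {x : Fin n → ℝ} (hx : ellpNorm p x = 1)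
    (G : Matrix (Fin n) (Fin n) ℝ) (i : Fin n) {σ c ε : ℝ} (hσ : |σ| = 1) (hc : 0 ≤ c)
    (hε : ε < 1) (h : ellpNorm p (x - (c * σ) • (basisVec i + v p G i)) ≤ ε) :
    ellpDist p x (nearOptimizers p G) ≤ 2 * ε := by
  set u := basisVec i + v p G i with hu
  rw [mul_smul] at h
  have hclose := ellpNorm_sub_normalize_le hp hx hc hε h
  rw [ellpNorm_smul (by linarith), hσ, one_mul] at hclose
  refine (ellpDist_le p x (S := nearOptimizers p G) ⟨i, ?_⟩).trans hclose
  rcases (abs_eq zero_le_one).1 hσ with rfl | rfl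
  · left
    rw [one_smul]
  · right
    rw [neg_one_smul, smul_neg]

end NearOptimizers

section Deterministic

variable {n : ℕ} {p q K : ℝ} {G : Matrix (Fin n) (Fin n) ℝ} {x : Fin n → ℝ}

lemma ellpNorm_indicator_rpow_add (hp : 0 < p) (S : Set (Fin n)) (x : Fin n → ℝ) :
    ellpNorm p (S.indicator x) ^ p + ellpNorm p (Sᶜ.indicator x) ^ p = ellpNorm p x ^ p := by
  simp only [ellpNorm_rpow hp, ← Finset.sum_add_distrib]
  refine Finset.sum_congr rfl fun i _ => ?_
  by_cases hi : i ∈ S <;> simp [hi, Real.zero_rpow hp.ne']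

lemma sqrt_log_le_errorScale (hp : 1 ≤ p) (hn : 0 < n) : √(Real.log n) ≤ errorScale p n :=
  le_mul_of_one_le_left (Real.sqrt_nonneg _)
    (Real.one_le_rpow (mod_cast hn) (by linarith))

lemma sqrt_hammingNorm_le_of_abs_le_indicator_heavySet (hp : 0 < p) (hn : 0 < n)
    (hx : ∑ i, |x i| ^ p ≤ 1) {u : Fin n → ℝ}
    (hu : ∀ i, |u i| ≤ |(heavySet p x).indicator x i|) :
    √(hammingNorm u) ≤ (n : ℝ) ^ ((p - 1) / 2) := by
  have hcard : hammingNorm u ≤ hammingNorm ((heavySet p x).indicator x) := by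
    unfold hammingNorm
    refine Finset.card_le_card (Finset.monotone_filter_right _ fun i _ hui hxi => hui ?_)
    simpa [hxi] using hu i
  calc √(hammingNorm u) ≤ √((n : ℝ) ^ (p - 1)) := by
        grw [hcard, hammingNorm_indicator_heavySet_le hp hn hx]
    _ = (n : ℝ) ^ ((p - 1) / 2) := by
        rw [Real.sqrt_eq_rpow, ← Real.rpow_mul n.cast_nonneg, mul_one_div]

lemma ColumnBound.dotProduct_symm_mulVec_indicator_heavySet_compl_le (hC : ColumnBound q K G)
    (hS : SignBound K G) (hK : 0 ≤ K) (hp2 : p ≤ 2) (hpq : p.HolderConjugate q) (hn : 0 < n)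
    (hx : ∑ i, |x i| ^ p ≤ 1) {u : Fin n → ℝ}
    (hu : ∀ i, |u i| ≤ |(heavySet p x).indicator x i|) :
    u ⬝ᵥ symm G *ᵥ (heavySet p x)ᶜ.indicator x ≤
      ellpNorm p ((heavySet p x)ᶜ.indicator x) * ellpNorm 2 u * (xi q * (n : ℝ) ^ (1 / q)) +
        5 * (K * errorScale p n) := by
  have hp0 : 0 < p := hpq.pos
  set z := (heavySet p x)ᶜ.indicator x
  have hnorm_le (w : Fin n → ℝ) (hw : ∀ i, |w i| ≤ |x i|) : ellpNorm p w ≤ 1 :=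
    (ellpNorm_le_ellpNorm hp0.le hw).trans (ellpNorm_le_of_sum_le hp0 zero_le_one (by simpa))
  have hux (i : Fin n) : |u i| ≤ |x i| := (hu i).trans (abs_indicator_le_abs _ x i)
  have hup : ellpNorm p u ≤ 1 := hnorm_le u hux
  have huz (i : Fin n) : u i = 0 ∨ z i = 0 := by
    by_cases hi : i ∈ heavySet p x
    · exact .inr (by simp [z, hi])
    · exact .inl (by simpa [hi] using hu i)
  have hz : ellpNorm p z ≤ 1 := hnorm_le z (abs_indicator_le_abs _ x)
  have hzu : ellpNorm p z * ellpNorm 2 u ≤ 1 :=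
    mul_le_one₀ hz (ellpNorm_nonneg 2 u) ((ellpNorm_anti hp0 hp2 u).trans hup)
  have hcard : √(hammingNorm u) * √(Real.log n) ≤ errorScale p n := by
    grw [sqrt_hammingNorm_le_of_abs_le_indicator_heavySet hp0 hn hx hu, errorScale]
  calc u ⬝ᵥ symm G *ᵥ z
      ≤ ellpNorm p z * (ellpNorm 2 u * (xi q * (n : ℝ) ^ (1 / q) +
          K * √(hammingNorm u) * √(Real.log n)) + 4 * (K * √(Real.log n))) :=
        hC.dotProduct_symm_mulVec_le hS hK hpq hn
          (fun i => (abs_le_ellpNorm hp0 u i).trans hup) huz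
    _ = ellpNorm p z * ellpNorm 2 u * (xi q * (n : ℝ) ^ (1 / q)) +
          (ellpNorm p z * ellpNorm 2 u * (K * (√(hammingNorm u) * √(Real.log n))) +
            ellpNorm p z * (4 * (K * √(Real.log n)))) := by ring
    _ ≤ ellpNorm p z * ellpNorm 2 u * (xi q * (n : ℝ) ^ (1 / q)) +
          (1 * (K * errorScale p n) + 1 * (4 * (K * errorScale p n))) := by
        gcongr _ + (?_ * (K * ?_) + ?_ * (4 * (K * ?_)))
        exact sqrt_log_le_errorScale hpq.lt.le hn
    _ = _ := by ring

/-- The factor `τ / δ` in the passage from the distance `δ` to the deficit `τ ^ 4` of the quadratic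
form, small enough for the stability estimate to apply for all `δ ≤ 1`. -/
noncomputable def deficitRatio (p : ℝ) : ℝ := 1 / (2 * stabilityConst p + alignmentConst p + 1)

/-- The coefficient of `errorScale` in the bound for the quadratic form. -/
noncomputable def errorConst (p K : ℝ) : ℝ := (8 / (2 - p) + 10 * √2) * K

lemma deficitRatio_pos (hp0 : 0 ≤ p) (hp2 : p < 2) : 0 < deficitRatio p := by
  have := stabilityConst_pos hp2
  have := alignmentConst_ge hp0 hp2
  unfold deficitRatio
  positivity

lemma errorConst_pos (hp : p < 2) (hK : 0 < K) : 0 < errorConst p K := by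
  have : 0 < 2 - p := by linarith
  unfold errorConst
  positivity

lemma exists_ellpNorm_sub_le_of_lt (hG : SignBound K G) (hC : ColumnBound q K G) (hK : 0 ≤ K)
    (hp2 : p < 2) (hpq : p.HolderConjugate q) (hn : 0 < n) (hx : ellpNorm p x = 1) {c τ : ℝ}
    (hc0 : 0 < c) (hc : c ^ p = 1 / 2) (hτ0 : 0 ≤ τ) (hτ : alignmentConst p * τ ^ 2 < 1)
    (hlt : √2 * c ^ 2 * (1 - τ ^ 4) * (xi q * (n : ℝ) ^ (1 / q)) +
      errorConst p K * errorScale p n < x ⬝ᵥ G *ᵥ x) :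
    ∃ i σ, |σ| = 1 ∧ ellpNorm p (x - (c * σ) • (basisVec i + dualVec p q (symm G i))) ≤
      stabilityConst p * τ := by
  have hp0 : 0 < p := hpq.pos
  have hξ : 0 < xi q := xi_pos hpq.symm.pos
  have hxsum : ∑ i, |x i| ^ p ≤ 1 := by rw [← ellpNorm_rpow hp0, hx, Real.one_rpow]
  have hlow := hlt.trans_le (hG.dotProduct_mulVec_self_le_cross_term hK hpq.lt.le hp2 hn hxsum)
  set S := heavySet p x
  rw [← Set.indicator_self_add_compl S x]
  refine exists_ellpNorm_add_sub_le hn hp2 hpq hc0 hc (N := xi q * (n : ℝ) ^ (1 / q))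
    (e := 5 * (K * errorScale p n)) ?_ (by positivity)
    (mul_nonneg (by norm_num) (mul_nonneg hK (errorScale_nonneg p n))) hτ0 hτ (fun i => ?_)
    (fun u hu => hC.dotProduct_symm_mulVec_indicator_heavySet_compl_le hG hK hp2.le hpq hn hxsum hu)
    ?_
  · rw [ellpNorm_indicator_rpow_add hp0, hx, Real.one_rpow]
  · refine (hC.ellpNorm_symm_row_le hG hpq.symm.lt.le i).trans ?_
    grw [sqrt_log_le_errorScale hpq.lt.le hn]
  · refine le_of_mul_le_mul_left ?_ (Real.sqrt_pos.2 two_pos)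
    rw [errorConst] at hlow
    linarith

lemma dotProduct_mulVec_self_le_of_le_ellpDist (hG : SignBound K G)
    (hC : ColumnBound (Real.conjExponent p) K G) (hK : 0 ≤ K) (hp1 : 1 < p) (hp2 : p < 2)
    (hn : 0 < n) (hx : ellpNorm p x = 1) {δ : ℝ} (hδ0 : 0 < δ) (hδ1 : δ ≤ 1)
    (hdist : δ ≤ ellpDist p x (nearOptimizers p G)) :
    x ⬝ᵥ G *ᵥ x ≤ √2 * ((2 : ℝ) ^ (-(1 / p))) ^ 2 * (1 - deficitRatio p ^ 4 * δ ^ 4) *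
      (xi (Real.conjExponent p) * (n : ℝ) ^ (1 / Real.conjExponent p)) +
        errorConst p K * errorScale p n := by
  by_contra! hlt
  have hp0 : 0 < p := by linarith
  have hA := alignmentConst_ge hp0.le hp2
  have hB := stabilityConst_pos hp2
  have hden : 0 < 2 * stabilityConst p + alignmentConst p + 1 := by positivity
  set τ := deficitRatio p * δ with hτ
  have hτ0 : 0 < τ := mul_pos (deficitRatio_pos hp0.le hp2) hδ0
  have hτδ : (2 * stabilityConst p + alignmentConst p + 1) * τ = δ := by
    rw [hτ, deficitRatio, ← mul_assoc, mul_one_div_cancel hden.ne', one_mul]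
  have hc : ((2 : ℝ) ^ (-(1 / p))) ^ p = 1 / 2 := by
    rw [← Real.rpow_mul zero_le_two, neg_mul, one_div_mul_cancel hp0.ne']
    norm_num
  rw [← mul_pow] at hlt
  obtain ⟨i, σ, hσ, hclose⟩ := exists_ellpNorm_sub_le_of_lt hG hC hK hp2
    (Real.HolderConjugate.conjExponent hp1) hn hx (by positivity) hc hτ0.le (by nlinarith) hlt
  rw [← v_eq_dualVec] at hclose
  have := ellpDist_nearOptimizers_le hp1.le hx G i hσ (by positivity) (by nlinarith) hclose
  nlinarith

end Deterministic

section Theorem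

lemma one_sub_le_measureReal_of_imp {Ω : Type*} [MeasurableSpace Ω] {P : Measure Ω}
    [IsProbabilityMeasure P] {A B : Ω → Prop} (hAB : ∀ ω, A ω → B ω) {ε : ℝ}
    (hA : P.real {ω | ¬ A ω} ≤ ε) : 1 - ε ≤ P.real {ω | B ω} := by
  have hcover : {ω | B ω} ∪ {ω | ¬ A ω} = Set.univ :=
    Set.eq_univ_of_forall fun ω => (em (A ω)).imp_left (hAB ω)
  have := measureReal_union_le (μ := P) {ω | B ω} {ω | ¬ A ω}
  rw [hcover, probReal_univ] at this
  linarith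

lemma two_le_conjExponent {p : ℝ} (hp1 : 1 < p) (hp2 : p ≤ 2) : 2 ≤ Real.conjExponent p := by
  rw [Real.conjExponent, le_div_iff₀ (by linarith)]
  linarith

lemma sqrt_two_mul_rpow_sq (p : ℝ) :
    √2 * ((2 : ℝ) ^ (-(1 / p))) ^ 2 = 2 ^ (1 / 2 - 2 / p) := by
  rw [Real.sqrt_eq_rpow, ← Real.rpow_natCast, ← Real.rpow_mul zero_le_two,
    ← Real.rpow_add two_pos]
  congr 1
  push_cast
  ring

lemma errorScale_eq {p : ℝ} (hp : 1 < p) (n : ℕ) :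
    errorScale p n = (n : ℝ) ^ (p / (2 * Real.conjExponent p)) * √(Real.log n) := by
  have : p - 1 ≠ 0 := by linarith
  rw [errorScale, Real.conjExponent]
  congr 2
  field

theorem theorem1p3_general (p : ℝ) (hp1 : 1 < p) (hp2 : p < 2) (d : ℝ) (hd : 0 < d) :
    ∃ C₁ C₂ C₃ : ℝ, 0 < C₁ ∧ 0 < C₂ ∧ 0 < C₃ ∧
      ∀ (n : ℕ), 1 ≤ n →
      ∀ (Ω : Type*) [MeasurableSpace Ω] (P : Measure Ω) [IsProbabilityMeasure P]
        (G : Ω → Matrix (Fin n) (Fin n) ℝ), IsStdGaussianMatrix P G →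
        1 - C₃ * (n : ℝ) ^ (-d) ≤
          P.real {ω | ∀ δ : ℝ, 0 < δ → δ ≤ 1 → ∀ x : Fin n → ℝ, ellpNorm p x = 1 →
            δ ≤ ellpDist p x (nearOptimizers p (G ω)) →
            (G ω *ᵥ x) ⬝ᵥ x ≤
              2 ^ (1 / 2 - 2 / p : ℝ) * (1 - C₁ * δ ^ 4) * xi (Real.conjExponent p) *
                  (n : ℝ) ^ (1 / Real.conjExponent p) +
                C₂ * (n : ℝ) ^ (p / (2 * Real.conjExponent p)) * √(Real.log n)} := by
  obtain ⟨K, C, hK, hC, htypical⟩ :=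
    exists_measureReal_not_typical_le (two_le_conjExponent hp1 hp2.le) hd.le
  refine ⟨deficitRatio p ^ 4, errorConst p K, C + 1, pow_pos (deficitRatio_pos (by linarith) hp2) 4,
    errorConst_pos hp2 hK, by positivity, fun n hn Ω _ P _ G hG => ?_⟩
  obtain rfl | hn2 : n = 1 ∨ 2 ≤ n := by omega
  · exact (by simp [hC.le] : _ ≤ (0 : ℝ)).trans measureReal_nonneg
  refine one_sub_le_measureReal_of_imp ?_ <| (htypical n hn2 Ω P G hG).trans
    (by gcongr; exact le_add_of_nonneg_right zero_le_one)
  rintro ω ⟨hS, hcol⟩ δ hδ0 hδ1 x hx hdist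
  rw [dotProduct_comm, ← sqrt_two_mul_rpow_sq, mul_assoc (errorConst p K), ← errorScale_eq hp1,
    mul_assoc _ (xi _)]
  exact dotProduct_mulVec_self_le_of_le_ellpDist hS hcol hK.le hp1 hp2 hn hx hδ0 hδ1 hdist

end Theorem

end GaussianGrothendieck

theorem theorem1p3 (p : ℝ) (hp1 : 1 < p) (hp2 : p < 2) (κ : ℝ) (hκ0 : 0 < κ)
    (hκ : κ < 1 / (3 * p)) (d : ℝ) (hd : 0 < d) :
    ∃ C₁ C₂ C₃ : ℝ, 0 < C₁ ∧ 0 < C₂ ∧ 0 < C₃ ∧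
      ∀ (n : ℕ), 1 ≤ n →
      ∀ (Ω : Type*) [MeasurableSpace Ω] (P : Measure Ω) [IsProbabilityMeasure P]
        (G : Ω → Matrix (Fin n) (Fin n) ℝ), GaussianGrothendieck.IsStdGaussianMatrix P G →
      ∀ δ : ℝ, (n : ℝ) ^ (-κ) ≤ δ → δ ≤ 1 →
        1 - C₃ * (n : ℝ) ^ (-d) ≤
          P.real {ω | ∀ x : Fin n → ℝ, GaussianGrothendieck.ellpNorm p x = 1 →
            δ ≤ GaussianGrothendieck.ellpDist p x (GaussianGrothendieck.nearOptimizers p (G ω)) →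
            (G ω *ᵥ x) ⬝ᵥ x ≤
              2 ^ (1 / 2 - 2 / p : ℝ) * (1 - C₁ * δ ^ 6) *
                  GaussianGrothendieck.xi (Real.conjExponent p) *
                  (n : ℝ) ^ (1 / Real.conjExponent p) +
                C₂ * (n : ℝ) ^ (p / (2 * Real.conjExponent p)) * √(Real.log n)} := by
  obtain ⟨C₁, C₂, C₃, hC₁, hC₂, hC₃, h⟩ := GaussianGrothendieck.theorem1p3_general p hp1 hp2 d hd
  refine ⟨C₁, C₂, C₃, hC₁, hC₂, hC₃, fun n hn Ω _ P _ G hG δ hδ hδ1 => (h n hn Ω P G hG).trans <|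
    measureReal_mono fun ω hω x hx hdist => ?_⟩
  have hδ0 : 0 < δ := hδ.trans_lt' (by positivity)
  grw [hω δ hδ0 hδ1 x hx hdist, pow_le_pow_of_le_one hδ0.le hδ1 (by norm_num : 4 ≤ 6)]
  exact GaussianGrothendieck.xi_nonneg _
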